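/- **Setting.** Let $M$ be a Polish space with its Borel $\sigma$-algebra, and let $\mathbb M$ (resp. $\mathscr P$) be the set of finite (resp. probability) Borel measures on $M$, with the weak topology. Let $\lambda$ be a $\sigma$-finite Borel measure on $M$, put $\mathbb M^{ac}=\{\mu\in\mathbb M:\mu\ll\lambda\}$ and $\mathscr P^{ac}=\mathbb M^{ac}\cap\mathscr P$, and equip both with the total variation distance $$\rho_{var}(\mu,\nu)=\int_M\Big|\frac{d\mu}{d\lambda}-\frac{d\nu}{d\lambda}\Big|\,d\lambda$$ and its Borel $\sigma$-algebra. Let $C_b^{E,1}(\mathbb M)$ be the space of continuous bounded $u:\mathbb M\to\mathbb R$ for which the extrinsic derivative $$D^Eu(\mu)(x)=\lim_{\varepsilon\downarrow0}\frac{u(\mu+\varepsilon\delta_x)-u(\mu)}{\varepsilon}$$ exists in $\mathbb R$ for all $(\mu,x)\in\mathbb M\times M$ and is continuous and bounded on $\mathbb M\times M$. Let $C_b^{E,1}(\mathscr P)$ be the space of continuous bounded $u:\mathscr P\to\mathbb R$ for which the convexity extrinsic derivative $$\tilde D^Eu(\mu)(x)=\lim_{\varepsilon\downarrow0}\frac{u((1-\varepsilon)\mu+\varepsilon\delta_x)-u(\mu)}{\varepsilon}$$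 exists in $\mathbb R$ for all $(\mu,x)\in\mathscr P\times M$ and is continuous and bounded on $\mathscr P\times M$. **Dirichlet forms.** Let $E$ be $\mathbb M^{ac}$ or $\mathscr P^{ac}$ and $\Lambda$ a Borel probability measure on $E$. A (symmetric) Dirichlet form on $L^2(E,\Lambda)$ is a symmetric bilinear form $(\mathcal E,\mathcal D(\mathcal E))$ with dense domain containing the constants, such that $\mathcal E(u,u)\ge0$, the form $\mathcal E_1(u,v)=\mathcal E(u,v)+\int uv\,d\Lambda$ satisfies $|\mathcal E_1(u,v)|\le K\sqrt{\mathcal E_1(u,u)\,\mathcal E_1(v,v)}$ for some constant $K$, $\mathcal D(\mathcal E)$ is complete under $\mathcal E_1^{1/2}$, and $u\in\mathcal D(\mathcal E)$ implies $u^+\wedge1\in\mathcal D(\mathcal E)$ and $\mathcal E(u^+\wedge1,u^+\wedge1)\le\mathcal E(u,u)$. For open $O$ let $\mathrm{Cap}_1(O)=\inf\{\mathcal E_1(u,u):u\in\mathcal D(\mathcal E),\ u\ge1\ \Lambda\text{-a.e. on }O\}$ with $\inf\emptyset=\infty$, and for $A\subseteq E$ let $\mathrm{Cap}_1(A)$ be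 the infimum of $\mathrm{Cap}_1(O)$ over open $O\supseteq A$. A nest is a sequence of closed sets $K_n$ with $\mathrm{Cap}_1(E\setminus K_n)\to0$. A measurable function on $E$ is quasi-continuous if for some nest its restriction to every $K_n$ is continuous. The form is quasi-regular if (Q1) there is a nest of compact sets, (Q2) $\mathcal D(\mathcal E)$ has an $\mathcal E_1^{1/2}$-dense linear subspace whose elements have quasi-continuous $\Lambda$-versions, and (Q3) there are a set $N$ with $\mathrm{Cap}_1(N)=0$ and a sequence of quasi-continuous functions, with classes in $\mathcal D(\mathcal E)$, that separates the points of $E\setminus N$. **Theorem.** (1) Let $\Lambda$ be a Borel probability measure on $\mathbb M^{ac}$ and let $J$ be a $\sigma$-finite Borel measure on $\mathbb M^{ac}\times\mathbb M^{ac}$ with $$\int\big[1\wedge\rho_{var}(\gamma,\eta)^2\big]\,dJ(\gamma,\eta)<\infty,\qquad J\ll\Lambda\times\Lambda .$$ Then for $u,v\in C_b^{E,1}(\mathbb M)$ (restricted to $\mathbb M^{ac}$, where they belong to $L^2(\Lambda)$) the integral $$\mathcal E^J(u,v)=\int\big(u(\gamma)-u(\eta)\big)\big(v(\gamma)-v(\eta)\big)\,dJ(\gamma,\eta)$$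 converges absolutely, and $(\mathcal E^J,C_b^{E,1}(\mathbb M))$ is closable in $L^2(\mathbb M^{ac},\Lambda)$: if $u_n\in C_b^{E,1}(\mathbb M)$, $u_n\to0$ in $L^2(\Lambda)$ and $\mathcal E^J(u_n-u_m,u_n-u_m)\to0$ as $n,m\to\infty$, then $\mathcal E^J(u_n,u_n)\to0$. Its closure is a quasi-regular Dirichlet form. Here the domain of the closure consists of the $L^2(\Lambda)$-limits $f$ of $\mathcal E^J$-Cauchy sequences $(u_n)$ in $C_b^{E,1}(\mathbb M)$, and its value at $(f,g)$ is $\lim_n\mathcal E^J(u_n,v_n)$ for any such sequences $(u_n)$ for $f$ and $(v_n)$ for $g$. (2) The same holds with $\mathbb M^{ac}$ and $C_b^{E,1}(\mathbb M)$ replaced by $\mathscr P^{ac}$ and $C_b^{E,1}(\mathscr P)$ throughout. -/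

import Mathlib

open MeasureTheory Filter Topology Set
open scoped ENNReal NNReal

noncomputable section

namespace ExtrinsicJump

/-! ### The extrinsic derivative and the classes `C_b^{E,1}`

`FiniteMeasure M` and `ProbabilityMeasure M` carry Mathlib's topology of weak convergence. -/

section Extrinsic

variable {M : Type*} [TopologicalSpace M] [MeasurableSpace M] [BorelSpace M]

/-- `D μ x` is the right derivative at `ε = 0` of `ε ↦ u (μ + ε δ_x)`, for every finite measure `μ`
and every point `x`. -/
def IsExtrinsicDeriv (u : FiniteMeasure M → ℝ) (D : FiniteMeasure M → M → ℝ) : Prop :=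
  ∀ (μ : FiniteMeasure M) (x : M),
    Tendsto (fun ε : ℝ≥0 => (u (μ + ε • (diracProba x).toFiniteMeasure) - u μ) / (ε : ℝ))
      (𝓝[>] 0) (𝓝 (D μ x))

/-- The probability measure `(1 - ε) μ + ε δ_x`, for `ε ∈ [0, 1]`. -/
def mixDirac (ε : unitInterval) (μ : ProbabilityMeasure M) (x : M) : ProbabilityMeasure M :=
  ⟨ENNReal.ofReal (1 - (ε : ℝ)) • (μ : Measure M) + ENNReal.ofReal (ε : ℝ) • Measure.dirac x, by
    constructor
    have h0 : (0 : ℝ) ≤ 1 - (ε : ℝ) := sub_nonneg.2 ε.2.2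
    simp only [Measure.coe_add, Measure.coe_smul, Pi.add_apply, Pi.smul_apply, measure_univ,
      smul_eq_mul, mul_one]
    rw [← ENNReal.ofReal_add h0 ε.2.1]
    simp⟩

/-- `D μ x` is the right derivative at `ε = 0` of `ε ↦ u ((1 - ε) μ + ε δ_x)`, for every probability
measure `μ` and every point `x`. -/
def IsConvexExtrinsicDeriv (u : ProbabilityMeasure M → ℝ) (D : ProbabilityMeasure M → M → ℝ) :
    Prop :=
  ∀ (μ : ProbabilityMeasure M) (x : M),
    Tendsto (fun ε : unitInterval => (u (mixDirac ε μ x) - u μ) / (ε : ℝ))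
      (𝓝[>] 0) (𝓝 (D μ x))

variable (M) in
/-- The space `C_b^{E,1}(𝕄)`: continuous functions on finite measures with a jointly continuous
extrinsic derivative, the function and the derivative being bounded. -/
def CbE1Finite : Submodule ℝ (FiniteMeasure M → ℝ) where
  carrier := {u | Continuous u ∧ ∃ D : FiniteMeasure M → M → ℝ, IsExtrinsicDeriv u D ∧
    Continuous (fun p : FiniteMeasure M × M => D p.1 p.2) ∧
    ∃ C : ℝ, ∀ μ x, |u μ| + |D μ x| ≤ C}
  add_mem' := by
    rintro u v ⟨hu, D, hD, hDc, C, hC⟩ ⟨hv, D', hD', hDc', C', hC'⟩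
    refine ⟨hu.add hv, fun μ x => D μ x + D' μ x, fun μ x => ?_, hDc.add hDc', C + C',
      fun μ x => ?_⟩
    · refine ((hD μ x).add (hD' μ x)).congr fun ε => ?_
      simp only [Pi.add_apply]
      ring
    · have h1 := hC μ x
      have h2 := hC' μ x
      have h3 := abs_add_le (u μ) (v μ)
      have h4 := abs_add_le (D μ x) (D' μ x)
      simp only [Pi.add_apply]
      linarith
  zero_mem' := ⟨continuous_const, fun _ _ => 0,
    fun μ x => by simp, continuous_const, 0, by simp⟩
  smul_mem' := by
    rintro c u ⟨hu, D, hD, hDc, C, hC⟩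
    refine ⟨hu.const_smul c, fun μ x => c * D μ x, fun μ x => ?_, hDc.const_mul c, |c| * C,
      fun μ x => ?_⟩
    · refine ((hD μ x).const_mul c).congr fun ε => ?_
      simp only [Pi.smul_apply, smul_eq_mul]
      ring
    · simp only [Pi.smul_apply, smul_eq_mul, abs_mul, ← mul_add]
      exact mul_le_mul_of_nonneg_left (hC μ x) (abs_nonneg c)

variable (M) in
/-- The space `C_b^{E,1}(𝒫)`: continuous functions on probability measures with a jointly continuous
convexity extrinsic derivative, the function and the derivative being bounded. -/
def CbE1Prob : Submodule ℝ (ProbabilityMeasure M → ℝ) where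
  carrier := {u | Continuous u ∧ ∃ D : ProbabilityMeasure M → M → ℝ, IsConvexExtrinsicDeriv u D ∧
    Continuous (fun p : ProbabilityMeasure M × M => D p.1 p.2) ∧
    ∃ C : ℝ, ∀ μ x, |u μ| + |D μ x| ≤ C}
  add_mem' := by
    rintro u v ⟨hu, D, hD, hDc, C, hC⟩ ⟨hv, D', hD', hDc', C', hC'⟩
    refine ⟨hu.add hv, fun μ x => D μ x + D' μ x, fun μ x => ?_, hDc.add hDc', C + C',
      fun μ x => ?_⟩
    · refine ((hD μ x).add (hD' μ x)).congr fun ε => ?_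
      simp only [Pi.add_apply]
      ring
    · have h1 := hC μ x
      have h2 := hC' μ x
      have h3 := abs_add_le (u μ) (v μ)
      have h4 := abs_add_le (D μ x) (D' μ x)
      simp only [Pi.add_apply]
      linarith
  zero_mem' := ⟨continuous_const, fun _ _ => 0,
    fun μ x => by simpa using tendsto_const_nhds, continuous_const, 0, by simp⟩
  smul_mem' := by
    rintro c u ⟨hu, D, hD, hDc, C, hC⟩
    refine ⟨hu.const_smul c, fun μ x => c * D μ x, fun μ x => ?_, hDc.const_mul c, |c| * C,
      fun μ x => ?_⟩
    · refine ((hD μ x).const_mul c).congr fun ε => ?_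
      simp only [Pi.smul_apply, smul_eq_mul]
      ring
    · simp only [Pi.smul_apply, smul_eq_mul, abs_mul, ← mul_add]
      exact mul_le_mul_of_nonneg_left (hC μ x) (abs_nonneg c)

end Extrinsic

/-! ### The spaces of absolutely continuous measures, with the total variation distance -/

section ACMeasures

variable {M : Type*} [MeasurableSpace M]

/-- `𝕄^ac`: the finite measures on `M` that are absolutely continuous with respect to `lam`. -/
def ACFinite (lam : Measure M) : Type _ :=
  {μ : Measure M // IsFiniteMeasure μ ∧ μ ≪ lam}

variable {lam : Measure M}

namespace ACFinite

/-- The density `h_μ = dμ / d lam`. -/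
def density (μ : ACFinite lam) (x : M) : ℝ := (μ.1.rnDeriv lam x).toReal

/-- `μ` as an element of the space of all finite measures. -/
def toFin (μ : ACFinite lam) : FiniteMeasure M := ⟨μ.1, μ.2.1⟩

theorem integrable_density (μ : ACFinite lam) : Integrable μ.density lam :=
  haveI := μ.2.1
  Measure.integrable_toReal_rnDeriv

/-- The total variation distance, `∫ |h_μ - h_ν| d lam`. -/
instance instMetricSpace [SigmaFinite lam] : MetricSpace (ACFinite lam) where
  dist μ ν := ∫ x, |μ.density x - ν.density x| ∂lam
  dist_self μ := by simp
  dist_comm μ ν := by simp only [abs_sub_comm]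
  dist_triangle μ ν κ := by
    have h1 := (μ.integrable_density.sub ν.integrable_density).abs
    have h2 := (ν.integrable_density.sub κ.integrable_density).abs
    have h3 := (μ.integrable_density.sub κ.integrable_density).abs
    refine (integral_mono h3 (h1.add h2) fun x => abs_sub_le (μ.density x) _ _).trans_eq ?_
    exact integral_add h1 h2
  eq_of_dist_eq_zero := by
    intro μ ν h
    have := μ.2.1
    have := ν.2.1
    have h1 := (μ.integrable_density.sub ν.integrable_density).abs
    have h2 := (integral_eq_zero_iff_of_nonneg (fun x => abs_nonneg _) h1).1 h
    have h3 : μ.1.rnDeriv lam =ᵐ[lam] ν.1.rnDeriv lam := by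
      filter_upwards [h2, μ.1.rnDeriv_lt_top lam, ν.1.rnDeriv_lt_top lam] with x hx h4 h5
      have h6 : μ.density x = ν.density x := sub_eq_zero.1 (abs_eq_zero.1 hx)
      exact (ENNReal.toReal_eq_toReal_iff' h4.ne h5.ne).1 h6
    apply Subtype.ext
    rw [← Measure.withDensity_rnDeriv_eq _ _ μ.2.2, ← Measure.withDensity_rnDeriv_eq _ _ ν.2.2]
    exact withDensity_congr_ae h3

instance instMeasurableSpace [SigmaFinite lam] : MeasurableSpace (ACFinite lam) :=
  borel (ACFinite lam)

instance instBorelSpace [SigmaFinite lam] : BorelSpace (ACFinite lam) := ⟨rfl⟩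

end ACFinite

/-- `𝒫^ac`: the probability measures on `M` that are absolutely continuous with respect to `lam`,
with the metric and the Borel sets of the subspace of `𝕄^ac`. -/
abbrev ACProb (lam : Measure M) : Type _ := {μ : ACFinite lam // IsProbabilityMeasure μ.1}

/-- `μ` as an element of the space of all probability measures. -/
def ACProb.toProb (μ : ACProb lam) : ProbabilityMeasure M := ⟨μ.1.1, μ.2⟩

/-- The restrictions to `𝕄^ac` of the functions of class `C_b^{E,1}(𝕄)`. -/
def coreFinite [TopologicalSpace M] [BorelSpace M] (lam : Measure M) :
    Submodule ℝ (ACFinite lam → ℝ) :=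
  (CbE1Finite M).map (LinearMap.funLeft ℝ ℝ ACFinite.toFin)

/-- The restrictions to `𝒫^ac` of the functions of class `C_b^{E,1}(𝒫)`. -/
def coreProb [TopologicalSpace M] [BorelSpace M] (lam : Measure M) :
    Submodule ℝ (ACProb lam → ℝ) :=
  (CbE1Prob M).map (LinearMap.funLeft ℝ ℝ ACProb.toProb)

end ACMeasures

/-! ### Dirichlet forms on `L²(E, Λ)`: closability, closure, quasi-regularity -/

section Dirichlet

variable {E : Type*} [MeasurableSpace E]

/-- A bilinear form defined on a linear subspace of `L²(E, Λ)`. -/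
structure L2Form (Λ : Measure E) where
  /-- The domain of the form. -/
  domain : Submodule ℝ (Lp ℝ 2 Λ)
  /-- The form. -/
  form : domain →ₗ[ℝ] domain →ₗ[ℝ] ℝ

namespace L2Form

variable {Λ : Measure E} (𝓔 : L2Form Λ)

/-- `𝓔₁(u, v) = 𝓔(u, v) + ∫ u v dΛ`. -/
def form1 (u v : 𝓔.domain) : ℝ := 𝓔.form u v + ∫ x, (u : Lp ℝ 2 Λ) x * (v : Lp ℝ 2 Λ) x ∂Λ

/-- Symmetric Dirichlet forms on `L²(E, Λ)` for a probability measure `Λ`, with the convention that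
constants belong to the domain. -/
structure IsDirichlet [IsProbabilityMeasure Λ] : Prop where
  dense_domain : Dense (𝓔.domain : Set (Lp ℝ 2 Λ))
  symm : ∀ u v, 𝓔.form u v = 𝓔.form v u
  nonneg : ∀ u, 0 ≤ 𝓔.form u u
  coercive : ∃ K : ℝ, 0 < K ∧ ∀ u v, |𝓔.form1 u v| ≤ K * √(𝓔.form1 u u * 𝓔.form1 v v)
  /-- The domain is complete for the norm `𝓔₁^{1/2}`. -/
  complete : ∀ u : ℕ → 𝓔.domain,
    Tendsto (fun p : ℕ × ℕ => 𝓔.form1 (u p.1 - u p.2) (u p.1 - u p.2)) atTop (𝓝 0) →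
    ∃ v : 𝓔.domain, Tendsto (fun n => 𝓔.form1 (u n - v) (u n - v)) atTop (𝓝 0)
  /-- `u⁺ ∧ 1` belongs to the domain and `𝓔(u⁺ ∧ 1) ≤ 𝓔(u)`. -/
  markov : ∀ u : 𝓔.domain, ∃ w : 𝓔.domain,
    ((w : Lp ℝ 2 Λ) : E → ℝ) =ᵐ[Λ] (fun x => min (max ((u : Lp ℝ 2 Λ) x) 0) 1) ∧
      𝓔.form w w ≤ 𝓔.form u u
  one_mem : Lp.const 2 Λ (1 : ℝ) ∈ 𝓔.domain

variable [TopologicalSpace E]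

/-- The `1`-capacity of an open set (an infimum in `[0, ∞]`, equal to `∞` if no function of the
domain is at least `1` on `O`). -/
def capOpen (O : Set E) : ℝ≥0∞ :=
  ⨅ (u : 𝓔.domain) (_ : ∀ᵐ x ∂Λ, x ∈ O → 1 ≤ (u : Lp ℝ 2 Λ) x), ENNReal.ofReal (𝓔.form1 u u)

/-- The `1`-capacity of an arbitrary set. -/
def cap (A : Set E) : ℝ≥0∞ := ⨅ (O : Set E) (_ : IsOpen O) (_ : A ⊆ O), 𝓔.capOpen O

/-- An `𝓔`-nest. -/
def IsNest (K : ℕ → Set E) : Prop :=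
  (∀ n, IsClosed (K n)) ∧ Tendsto (fun n => 𝓔.cap (K n)ᶜ) atTop (𝓝 0)

/-- Quasi-continuous functions. -/
def QuasiContinuous (f : E → ℝ) : Prop :=
  Measurable f ∧ ∃ K : ℕ → Set E, 𝓔.IsNest K ∧ ∀ n, ContinuousOn f (K n)

/-- Quasi-regularity. A function belongs to the domain if its `Λ`-class does. -/
structure IsQuasiRegular : Prop where
  /-- There is a nest of compact sets. -/
  tight : ∃ K : ℕ → Set E, 𝓔.IsNest K ∧ ∀ n, IsCompact (K n)
  /-- There is an `𝓔₁^{1/2}`-dense subspace of the domain whose elements have quasi-continuous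
  versions. -/
  dense_quasiContinuous : ∃ S : Submodule ℝ 𝓔.domain,
    (∀ v ∈ S, ∃ f : E → ℝ, 𝓔.QuasiContinuous f ∧ f =ᵐ[Λ] (v : Lp ℝ 2 Λ)) ∧
    ∀ u : 𝓔.domain, ∀ ε : ℝ, 0 < ε → ∃ v ∈ S, 𝓔.form1 (u - v) (u - v) < ε
  /-- Outside a set of zero capacity, the points are separated by a sequence of quasi-continuous
  functions of the domain. -/
  separating : ∃ N : Set E, 𝓔.cap N = 0 ∧ ∃ f : ℕ → E → ℝ,
    (∀ n, 𝓔.QuasiContinuous (f n) ∧ ∃ u : 𝓔.domain, f n =ᵐ[Λ] (u : Lp ℝ 2 Λ)) ∧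
    ∀ x ∈ Nᶜ, ∀ y ∈ Nᶜ, x ≠ y → ∃ n, f n x ≠ f n y

end L2Form

/-- `B(u_n - u_m, u_n - u_m) → 0` as `n, m → ∞`. -/
def FormCauchy (B : (E → ℝ) → (E → ℝ) → ℝ) (u : ℕ → E → ℝ) : Prop :=
  Tendsto (fun p : ℕ × ℕ => B (u p.1 - u p.2) (u p.1 - u p.2)) atTop (𝓝 0)

/-- The form `B` on the linear space `𝓒` of functions is closable in `L²(E, Λ)`. -/
def IsClosable (Λ : Measure E) (𝓒 : Submodule ℝ (E → ℝ)) (B : (E → ℝ) → (E → ℝ) → ℝ) : Prop :=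
  ∀ u : ℕ → E → ℝ, (∀ n, u n ∈ 𝓒) → Tendsto (fun n => eLpNorm (u n) 2 Λ) atTop (𝓝 0) →
    FormCauchy B u → Tendsto (fun n => B (u n) (u n)) atTop (𝓝 0)

/-- `u` is a `B`-Cauchy sequence in `𝓒` that converges to `f` in `L²(E, Λ)`. -/
structure IsApprox (Λ : Measure E) (𝓒 : Submodule ℝ (E → ℝ)) (B : (E → ℝ) → (E → ℝ) → ℝ)
    (u : ℕ → E → ℝ) (f : Lp ℝ 2 Λ) : Prop where
  mem : ∀ n, u n ∈ 𝓒
  tendsto : Tendsto (fun n => eLpNorm (fun x => u n x - f x) 2 Λ) atTop (𝓝 0)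
  cauchy : FormCauchy B u

/-- `𝓔` is the closure in `L²(E, Λ)` of the form `B` on `𝓒`: its domain consists of the `L²`-limits
`f` of `B`-Cauchy sequences `u_n` in `𝓒`, and `𝓔(f, g) = lim B(u_n, v_n)` whatever the approximating
sequences `u_n` of `f` and `v_n` of `g`. This determines `𝓔`. -/
structure IsClosure (Λ : Measure E) (𝓒 : Submodule ℝ (E → ℝ)) (B : (E → ℝ) → (E → ℝ) → ℝ)
    (𝓔 : L2Form Λ) : Prop where
  mem_domain_iff : ∀ f : Lp ℝ 2 Λ, f ∈ 𝓔.domain ↔ ∃ u, IsApprox Λ 𝓒 B u f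
  form_eq : ∀ (f g : 𝓔.domain) (u v : ℕ → E → ℝ), IsApprox Λ 𝓒 B u f → IsApprox Λ 𝓒 B v g →
    Tendsto (fun n => B (u n) (v n)) atTop (𝓝 (𝓔.form f g))

/-- The jump form `∫ (u(γ) - u(η)) (v(γ) - v(η)) dJ(γ, η)`. -/
def jumpForm (J : Measure (E × E)) (u v : E → ℝ) : ℝ :=
  ∫ p, (u p.1 - u p.2) * (v p.1 - v p.2) ∂J

end Dirichlet

end ExtrinsicJump

end

open ExtrinsicJump

/-! The jump form is the squared norm of the difference operator `f ↦ f(γ) - f(η)` from `L²(Λ)` to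
`L²(J)`. Because `J ≪ Λ × Λ`, a `Λ`-null set is `J`-null in either coordinate, so the operator is
well defined on classes. A.e. convergent subsequences show that its maximal graph is closed
(`isClosed_jumpGraph`). Hence the closure of the graph over the core is single-valued, which is
closability, and the closed form is the pull-back of the inner product of `L²(J)`.

Everything else depends on the core only through `LipschitzCore`: its functions are bounded and
Lipschitz, it is stable under `C¹` maps, and it nearly attains `arctan (dist · ν)` at any given
point from below. The Lipschitz bound and the integrability of `1 ∧ dist²` give finite energy. `C¹`
stability makes the domain a lattice (`MemDomain.abs`), hence Markovian. It also makes the core an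
algebra, and as this algebra separates points it is dense in `L²`.

For quasi-regularity, finite suprema of core functions approximate `arctan (dist · ν)`, which
therefore lies in the domain (`LipschitzCore.memDomain_arctanDist`). The minima of these functions
over the first `n` points of a dense sequence tend to `0` in the domain. A subsequence does so
uniformly off sets of small capacity, and the sets of uniform convergence are totally bounded and
closed, thus compact.

It remains to verify `LipschitzCore`. A bounded derivative in the directions `δ_x` controls the
effect of adding finitely many atoms, and, by weak density of such measures, of adding any finite
measure (`abs_sub_zero_le_mass`). Two measures arise from their common part, of density `min(h_μ,
h_ν)`, by adding masses of total `dist μ ν`, so the core is Lipschitz in total variation. For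
probability measures the same argument is applied to `ν ↦ u((κ + ν)/(κ + ν)(M))`. -/

noncomputable section

namespace ExtrinsicJump

/-! ### Closed graph of the difference operator; closability and closure -/

section Graph

variable {E : Type*}

/-- The difference `f(γ) - f(η)`. -/
def jumpDiff (f : E → ℝ) (p : E × E) : ℝ := f p.1 - f p.2

theorem jumpDiff_add (f g : E → ℝ) : jumpDiff (f + g) = jumpDiff f + jumpDiff g := by
  ext p; simp only [jumpDiff, Pi.add_apply]; ring

theorem jumpDiff_sub (f g : E → ℝ) : jumpDiff (f - g) = jumpDiff f - jumpDiff g := by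
  ext p; simp only [jumpDiff, Pi.sub_apply]; ring

theorem jumpDiff_smul (c : ℝ) (f : E → ℝ) : jumpDiff (c • f) = c • jumpDiff f := by
  ext p; simp only [jumpDiff, Pi.smul_apply, smul_eq_mul]; ring

variable [MeasurableSpace E]

theorem jumpForm_eq (J : Measure (E × E)) (u v : E → ℝ) :
    jumpForm J u v = ∫ p, jumpDiff u p * jumpDiff v p ∂J := rfl

/-- The one point where absolute continuity of `J` enters: both coordinate projections pull `Λ`-null
sets back to `J`-null sets. -/
theorem ae_fst_snd {Λ : Measure E} [SFinite Λ] {J : Measure (E × E)} (hJ : J ≪ Λ.prod Λ)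
    {P : E → Prop} (h : ∀ᵐ x ∂Λ, P x) : ∀ᵐ p ∂J, P p.1 ∧ P p.2 :=
  hJ.ae_le ((Measure.quasiMeasurePreserving_fst.ae h).and
    (Measure.quasiMeasurePreserving_snd.ae h))

theorem jumpDiff_congr_ae {Λ : Measure E} [SFinite Λ] {J : Measure (E × E)} (hJ : J ≪ Λ.prod Λ)
    {f g : E → ℝ} (h : f =ᵐ[Λ] g) : jumpDiff f =ᵐ[J] jumpDiff g := by
  filter_upwards [ae_fst_snd hJ h] with p hp
  rw [jumpDiff, jumpDiff, hp.1, hp.2]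

theorem tendsto_eLpNorm_zero_of_dominated {α : Type*} [MeasurableSpace α] {μ : Measure α}
    {F : ℕ → α → ℝ} {G : α → ℝ} (hF : ∀ n, AEStronglyMeasurable (F n) μ) (hG : MemLp G 2 μ)
    (bound : ∀ n, ∀ᵐ x ∂μ, |F n x| ≤ G x)
    (lim : ∀ᵐ x ∂μ, Tendsto (fun n => F n x) atTop (𝓝 0)) :
    Tendsto (fun n => eLpNorm (F n) 2 μ) atTop (𝓝 0) := by
  have h2 : (2 : ℝ≥0∞) ≠ 0 := by norm_num
  have h2' : (2 : ℝ≥0∞) ≠ ∞ := by norm_num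
  simp only [eLpNorm_eq_lintegral_rpow_enorm_toReal h2 h2', ENNReal.toReal_ofNat]
  have key : Tendsto (fun n => ∫⁻ x, ‖F n x‖ₑ ^ (2 : ℝ) ∂μ) atTop (𝓝 (∫⁻ _, 0 ∂μ)) := by
    refine tendsto_lintegral_of_dominated_convergence' (fun x => ‖G x‖ₑ ^ (2 : ℝ))
      (fun n => (hF n).enorm.pow_const _) (fun n => ?_) ?_ ?_
    · filter_upwards [bound n] with x hx
      refine ENNReal.rpow_le_rpow ?_ (by norm_num)
      rw [Real.enorm_eq_ofReal_abs, Real.enorm_eq_ofReal_abs]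
      exact ENNReal.ofReal_le_ofReal (hx.trans (le_abs_self _))
    · simpa using (lintegral_rpow_enorm_lt_top_of_eLpNorm_lt_top h2 h2' hG.2).ne
    · filter_upwards [lim] with x hx
      have h3 : Tendsto (fun n => ‖F n x‖ₑ) atTop (𝓝 0) := by simpa using hx.enorm
      simpa [Function.comp_def] using
        (ENNReal.continuous_rpow_const (y := (2 : ℝ))).continuousAt.tendsto.comp h3
  rw [lintegral_zero] at key
  have := (ENNReal.continuous_rpow_const (y := 1 / (2 : ℝ))).continuousAt.tendsto.comp key
  simpa [Function.comp_def] using this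

variable (Λ : Measure E) (J : Measure (E × E)) (𝓒 : Submodule ℝ (E → ℝ))

/-- The pairs `(u, u(γ) - u(η))`, for `u` in the core. -/
def coreGraph : Submodule ℝ (Lp ℝ 2 Λ × Lp ℝ 2 J) where
  carrier := {q | ∃ u ∈ 𝓒, q.1 =ᵐ[Λ] u ∧ q.2 =ᵐ[J] jumpDiff u}
  add_mem' := by
    rintro q r ⟨u, hu, h1, h2⟩ ⟨v, hv, h3, h4⟩
    refine ⟨u + v, 𝓒.add_mem hu hv, (Lp.coeFn_add _ _).trans (h1.add h3), ?_⟩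
    rw [jumpDiff_add]
    exact (Lp.coeFn_add _ _).trans (h2.add h4)
  zero_mem' := by
    refine ⟨0, 𝓒.zero_mem, Lp.coeFn_zero _ _ _, (Lp.coeFn_zero _ _ _).trans ?_⟩
    exact Eventually.of_forall fun p => by simp [jumpDiff]
  smul_mem' := by
    rintro c q ⟨u, hu, h1, h2⟩
    refine ⟨c • u, 𝓒.smul_mem c hu, (Lp.coeFn_smul _ _).trans (h1.const_smul c), ?_⟩
    rw [jumpDiff_smul]
    exact (Lp.coeFn_smul _ _).trans (h2.const_smul c)

/-- The closure of the graph of `u ↦ u(γ) - u(η)` on the core. -/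
def closedGraph : Submodule ℝ (Lp ℝ 2 Λ × Lp ℝ 2 J) := (coreGraph Λ J 𝓒).topologicalClosure

variable {Λ J 𝓒}

theorem exists_subseq_ae {α : Type*} [MeasurableSpace α] {μ : Measure α} {f : ℕ → Lp ℝ 2 μ}
    {g : Lp ℝ 2 μ} (h : Tendsto f atTop (𝓝 g)) :
    ∃ ns : ℕ → ℕ, StrictMono ns ∧
      ∀ᵐ x ∂μ, Tendsto (fun i => f (ns i) x) atTop (𝓝 (g x)) :=
  (tendstoInMeasure_of_tendsto_Lp h).exists_seq_tendsto_ae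

/-- The graph of `f ↦ f(γ) - f(η)` is closed. -/
theorem isClosed_jumpGraph [SFinite Λ] (hJ : J ≪ Λ.prod Λ) :
    IsClosed {q : Lp ℝ 2 Λ × Lp ℝ 2 J | q.2 =ᵐ[J] jumpDiff q.1} := by
  refine IsSeqClosed.isClosed fun q r hq hr => ?_
  obtain ⟨ns, hns, h1⟩ := exists_subseq_ae ((continuous_fst.tendsto r).comp hr)
  -- Extracted from the first subsequence, so that both components converge a.e. along a common one.
  obtain ⟨ms, hms, h2⟩ := exists_subseq_ae
    (((continuous_snd.tendsto r).comp hr).comp hns.tendsto_atTop)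
  have h3 : ∀ᵐ p ∂J, ∀ n, (q n).2 p = jumpDiff (q n).1 p := ae_all_iff.2 hq
  filter_upwards [h2, h3, ae_fst_snd hJ h1] with p hp2 hp3 hp1
  refine tendsto_nhds_unique hp2 ?_
  have h4 := (hp1.1.comp hms.tendsto_atTop).sub (hp1.2.comp hms.tendsto_atTop)
  exact h4.congr fun n => (hp3 _).symm

theorem closedGraph_ae [SFinite Λ] (hJ : J ≪ Λ.prod Λ) {q : Lp ℝ 2 Λ × Lp ℝ 2 J}
    (hq : q ∈ closedGraph Λ J 𝓒) : q.2 =ᵐ[J] jumpDiff q.1 := by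
  refine closure_minimal ?_ (isClosed_jumpGraph hJ) hq
  rintro q ⟨u, -, h1, h2⟩
  exact h2.trans (jumpDiff_congr_ae hJ h1.symm)

/-- The first component determines the second as its difference function. This is closability in
graph form, and it makes the closed graph the graph of an operator. -/
theorem closedGraph_snd_eq_zero [SFinite Λ] (hJ : J ≪ Λ.prod Λ) (q : Lp ℝ 2 Λ × Lp ℝ 2 J)
    (hq : q ∈ closedGraph Λ J 𝓒) (h0 : q.1 = 0) : q.2 = 0 := by
  have h1 := closedGraph_ae hJ hq
  rw [h0] at h1
  refine Lp.ext (h1.trans ((jumpDiff_congr_ae hJ (Lp.coeFn_zero ℝ 2 Λ)).trans ?_))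
  refine EventuallyEq.trans ?_ (Lp.coeFn_zero ℝ 2 J).symm
  exact Eventually.of_forall fun p => by simp [jumpDiff]

theorem isClosed_closedGraph : IsClosed (closedGraph Λ J 𝓒 : Set (Lp ℝ 2 Λ × Lp ℝ 2 J)) :=
  Submodule.isClosed_topologicalClosure _

/-- The core consists of square integrable functions of finite energy. -/
def FiniteEnergy (Λ : Measure E) (J : Measure (E × E)) (𝓒 : Submodule ℝ (E → ℝ)) : Prop :=
  ∀ u ∈ 𝓒, MemLp u 2 Λ ∧ MemLp (jumpDiff u) 2 J

/-- The point of the graph given by a function. -/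
def graphPoint (f : E → ℝ) (h : MemLp f 2 Λ ∧ MemLp (jumpDiff f) 2 J) : Lp ℝ 2 Λ × Lp ℝ 2 J :=
  (h.1.toLp f, h.2.toLp (jumpDiff f))

theorem graphPoint_mem {u : E → ℝ} (hu : u ∈ 𝓒) (h : MemLp u 2 Λ ∧ MemLp (jumpDiff u) 2 J) :
    graphPoint u h ∈ closedGraph Λ J 𝓒 :=
  subset_closure ⟨u, hu, h.1.coeFn_toLp, h.2.coeFn_toLp⟩

theorem jumpForm_eq_inner {u v : E → ℝ} (hu : MemLp (jumpDiff u) 2 J)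
    (hv : MemLp (jumpDiff v) 2 J) :
    jumpForm J u v = inner ℝ (hu.toLp (jumpDiff u)) (hv.toLp (jumpDiff v)) := by
  rw [L2.inner_def, jumpForm_eq]
  refine integral_congr_ae ?_
  filter_upwards [hu.coeFn_toLp, hv.coeFn_toLp] with p h1 h2
  simp [h1, h2, mul_comm]

theorem jumpForm_sub_self {u v : E → ℝ} (hu : MemLp (jumpDiff u) 2 J)
    (hv : MemLp (jumpDiff v) 2 J) :
    jumpForm J (u - v) (u - v) = ‖hu.toLp (jumpDiff u) - hv.toLp (jumpDiff v)‖ ^ 2 := by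
  have h : MemLp (jumpDiff (u - v)) 2 J := by rw [jumpDiff_sub]; exact hu.sub hv
  rw [jumpForm_eq_inner h h, real_inner_self_eq_norm_sq, ← MemLp.toLp_sub]
  congr 2
  exact MemLp.toLp_congr _ _ (by rw [jumpDiff_sub])

theorem tendsto_norm_of_sq {ι : Type*} {l : Filter ι} {a : ι → ℝ} (h0 : ∀ i, 0 ≤ a i)
    (h : Tendsto (fun i => a i ^ 2) l (𝓝 0)) : Tendsto a l (𝓝 0) := by
  have := (Real.continuous_sqrt.tendsto 0).comp h
  simpa [Function.comp_def, Real.sqrt_sq (h0 _)] using this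

theorem formCauchy_iff (h : FiniteEnergy Λ J 𝓒) {u : ℕ → E → ℝ} (hu : ∀ n, u n ∈ 𝓒) :
    FormCauchy (jumpForm J) u ↔
      CauchySeq fun n => (h (u n) (hu n)).2.toLp (jumpDiff (u n)) := by
  rw [FormCauchy, cauchySeq_iff_tendsto_dist_atTop_0]
  simp only [fun p : ℕ × ℕ => jumpForm_sub_self (h _ (hu p.1)).2 (h _ (hu p.2)).2, dist_eq_norm]
  refine ⟨tendsto_norm_of_sq fun _ => norm_nonneg _, fun h => by simpa using h.pow 2⟩

theorem isClosable_jumpForm [SFinite Λ] (hJ : J ≪ Λ.prod Λ) (h : FiniteEnergy Λ J 𝓒) :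
    IsClosable Λ 𝓒 (jumpForm J) := by
  intro u hu hu0 hc
  obtain ⟨g, hg⟩ := cauchySeq_tendsto_of_complete ((formCauchy_iff h hu).1 hc)
  have h1 : Tendsto (fun n => (h (u n) (hu n)).1.toLp (u n)) atTop (𝓝 0) := by
    rw [tendsto_zero_iff_norm_tendsto_zero]
    simp only [Lp.norm_toLp]
    simpa [Function.comp_def] using (ENNReal.tendsto_toReal ENNReal.zero_ne_top).comp hu0
  have h2 : ((0, g) : Lp ℝ 2 Λ × Lp ℝ 2 J) ∈ closedGraph Λ J 𝓒 :=
    isClosed_closedGraph.mem_of_tendsto (h1.prodMk_nhds hg)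
      (Eventually.of_forall fun n => graphPoint_mem (hu n) (h _ (hu n)))
  have h3 : g = 0 := closedGraph_snd_eq_zero hJ _ h2 rfl
  simp only [fun n => jumpForm_eq_inner (h _ (hu n)).2 (h _ (hu n)).2, real_inner_self_eq_norm_sq]
  simpa [h3] using (hg.norm.pow 2)

/-- Since `L²(J)` is complete, a form-Cauchy sequence has convergent differences; approximation thus
becomes convergence in the product space. -/
theorem isApprox_iff (h : FiniteEnergy Λ J 𝓒) {u : ℕ → E → ℝ} {f : Lp ℝ 2 Λ} :
    IsApprox Λ 𝓒 (jumpForm J) u f ↔ ∃ hu : ∀ n, u n ∈ 𝓒, ∃ g, (f, g) ∈ closedGraph Λ J 𝓒 ∧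
      Tendsto (fun n => graphPoint (u n) (h _ (hu n))) atTop (𝓝 (f, g)) := by
  have key (hu : ∀ n, u n ∈ 𝓒) :
      Tendsto (fun n => eLpNorm (fun x => u n x - f x) 2 Λ) atTop (𝓝 0) ↔
      Tendsto (fun n => (h (u n) (hu n)).1.toLp (u n)) atTop (𝓝 f) := by
    rw [Lp.tendsto_Lp_iff_tendsto_eLpNorm']
    refine tendsto_congr fun n => eLpNorm_congr_ae ?_
    filter_upwards [(h (u n) (hu n)).1.coeFn_toLp] with x hx
    simp [hx]
  constructor
  · rintro ⟨hu, h1, h2⟩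
    obtain ⟨g, hg⟩ := cauchySeq_tendsto_of_complete ((formCauchy_iff h hu).1 h2)
    have h3 := ((key hu).1 h1).prodMk_nhds hg
    exact ⟨hu, g, isClosed_closedGraph.mem_of_tendsto h3
      (Eventually.of_forall fun n => graphPoint_mem (hu n) (h _ (hu n))), h3⟩
  · rintro ⟨hu, g, -, h2⟩
    refine ⟨hu, (key hu).2 ((continuous_fst.tendsto _).comp h2), (formCauchy_iff h hu).2 ?_⟩
    exact ((continuous_snd.tendsto _).comp h2).cauchySeq

theorem exists_seq_of_mem_closedGraph (h : FiniteEnergy Λ J 𝓒) {q : Lp ℝ 2 Λ × Lp ℝ 2 J}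
    (hq : q ∈ closedGraph Λ J 𝓒) : ∃ u : ℕ → E → ℝ, ∃ hu : ∀ n, u n ∈ 𝓒,
      Tendsto (fun n => graphPoint (u n) (h _ (hu n))) atTop (𝓝 q) := by
  obtain ⟨r, hr, hrq⟩ := mem_closure_iff_seq_limit.1 hq
  choose u hu h1 h2 using hr
  refine ⟨u, hu, hrq.congr fun n => Prod.ext ?_ ?_⟩
  · exact Lp.ext ((h1 n).trans (h _ (hu n)).1.coeFn_toLp.symm)
  · exact Lp.ext ((h2 n).trans (h _ (hu n)).2.coeFn_toLp.symm)

variable (Λ J 𝓒) in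
/-- The closure of the jump form. -/
def closureForm : L2Form Λ where
  domain := (closedGraph Λ J 𝓒).toLinearPMap.domain
  form := (innerₗ (Lp ℝ 2 J)).compl₁₂ (closedGraph Λ J 𝓒).toLinearPMap.toFun
    (closedGraph Λ J 𝓒).toLinearPMap.toFun

variable (Λ J 𝓒) in
/-- The difference `f(γ) - f(η)`, for `f` in the domain of the closure. -/
def jumpGrad : (closureForm Λ J 𝓒).domain →ₗ[ℝ] Lp ℝ 2 J :=
  (closedGraph Λ J 𝓒).toLinearPMap.toFun

theorem closureForm_form (f g : (closureForm Λ J 𝓒).domain) :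
    (closureForm Λ J 𝓒).form f g = inner ℝ (jumpGrad Λ J 𝓒 f) (jumpGrad Λ J 𝓒 g) := rfl

theorem closureForm_form1 (f g : (closureForm Λ J 𝓒).domain) :
    (closureForm Λ J 𝓒).form1 f g =
      inner ℝ (jumpGrad Λ J 𝓒 f) (jumpGrad Λ J 𝓒 g) + inner ℝ (f : Lp ℝ 2 Λ) g := by
  rw [L2Form.form1, closureForm_form, L2.inner_def (𝕜 := ℝ) (f : Lp ℝ 2 Λ)]
  congr 1
  refine integral_congr_ae (Eventually.of_forall fun x => ?_)
  simp [mul_comm]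

theorem closureForm_form1_self (f : (closureForm Λ J 𝓒).domain) :
    (closureForm Λ J 𝓒).form1 f f = ‖jumpGrad Λ J 𝓒 f‖ ^ 2 + ‖(f : Lp ℝ 2 Λ)‖ ^ 2 := by
  rw [closureForm_form1, real_inner_self_eq_norm_sq, real_inner_self_eq_norm_sq]

theorem mem_closureForm_domain {f : Lp ℝ 2 Λ} :
    f ∈ (closureForm Λ J 𝓒).domain ↔ ∃ g, (f, g) ∈ closedGraph Λ J 𝓒 := by
  change f ∈ (closedGraph Λ J 𝓒).toLinearPMap.domain ↔ _
  rw [Submodule.toLinearPMap_domain]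
  simp

theorem jumpGrad_mem [SFinite Λ] (hJ : J ≪ Λ.prod Λ) (f : (closureForm Λ J 𝓒).domain) :
    ((f : Lp ℝ 2 Λ), jumpGrad Λ J 𝓒 f) ∈ closedGraph Λ J 𝓒 :=
  Submodule.mem_graph_toLinearPMap (closedGraph_snd_eq_zero hJ) f

theorem jumpGrad_eq [SFinite Λ] (hJ : J ≪ Λ.prod Λ) (f : (closureForm Λ J 𝓒).domain)
    {g : Lp ℝ 2 J} (h : ((f : Lp ℝ 2 Λ), g) ∈ closedGraph Λ J 𝓒) : jumpGrad Λ J 𝓒 f = g := by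
  have := closedGraph_snd_eq_zero hJ _ (Submodule.sub_mem _ (jumpGrad_mem hJ f) h) (by simp)
  exact sub_eq_zero.1 this

theorem isClosure_closureForm [SFinite Λ] (hJ : J ≪ Λ.prod Λ) (h : FiniteEnergy Λ J 𝓒) :
    IsClosure Λ 𝓒 (jumpForm J) (closureForm Λ J 𝓒) where
  mem_domain_iff f := by
    rw [mem_closureForm_domain]
    constructor
    · rintro ⟨g, hg⟩
      obtain ⟨u, hu, h1⟩ := exists_seq_of_mem_closedGraph h hg
      exact ⟨u, (isApprox_iff h).2 ⟨hu, g, hg, h1⟩⟩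
    · rintro ⟨u, hu⟩
      obtain ⟨-, g, hg, -⟩ := (isApprox_iff h).1 hu
      exact ⟨g, hg⟩
  form_eq f g u v hu hv := by
    obtain ⟨hu, f', hf, h1⟩ := (isApprox_iff h).1 hu
    obtain ⟨hv, g', hg, h2⟩ := (isApprox_iff h).1 hv
    rw [closureForm_form, jumpGrad_eq hJ f hf, jumpGrad_eq hJ g hg]
    simp only [fun n => jumpForm_eq_inner (h _ (hu n)).2 (h _ (hv n)).2]
    exact ((continuous_snd.tendsto _).comp h1).inner ((continuous_snd.tendsto _).comp h2)

/-- `𝓔₁` is the squared graph norm, and a closed graph in a product of complete spaces is complete.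
-/
theorem closureForm_complete [SFinite Λ] (hJ : J ≪ Λ.prod Λ)
    (u : ℕ → (closureForm Λ J 𝓒).domain)
    (hu : Tendsto (fun p : ℕ × ℕ => (closureForm Λ J 𝓒).form1 (u p.1 - u p.2) (u p.1 - u p.2))
      atTop (𝓝 0)) :
    ∃ v : (closureForm Λ J 𝓒).domain,
      Tendsto (fun n => (closureForm Λ J 𝓒).form1 (u n - v) (u n - v)) atTop (𝓝 0) := by
  simp only [closureForm_form1_self, map_sub, Submodule.coe_sub] at hu ⊢
  have h1 : CauchySeq fun n => jumpGrad Λ J 𝓒 (u n) := by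
    rw [cauchySeq_iff_tendsto_dist_atTop_0]
    simp only [dist_eq_norm]
    refine tendsto_norm_of_sq (fun _ => norm_nonneg _) (squeeze_zero (fun _ => by positivity)
      (fun p => ?_) hu)
    exact le_add_of_nonneg_right (by positivity)
  have h2 : CauchySeq fun n => (u n : Lp ℝ 2 Λ) := by
    rw [cauchySeq_iff_tendsto_dist_atTop_0]
    simp only [dist_eq_norm]
    refine tendsto_norm_of_sq (fun _ => norm_nonneg _) (squeeze_zero (fun _ => by positivity)
      (fun p => ?_) hu)
    exact le_add_of_nonneg_left (by positivity)
  obtain ⟨g, hg⟩ := cauchySeq_tendsto_of_complete h1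
  obtain ⟨f, hf⟩ := cauchySeq_tendsto_of_complete h2
  have h3 : (f, g) ∈ closedGraph Λ J 𝓒 := isClosed_closedGraph.mem_of_tendsto
    (hf.prodMk_nhds hg) (Eventually.of_forall fun n => jumpGrad_mem hJ (u n))
  refine ⟨⟨f, mem_closureForm_domain.2 ⟨g, h3⟩⟩, ?_⟩
  rw [jumpGrad_eq hJ _ h3]
  simpa using ((tendsto_iff_norm_sub_tendsto_zero.1 hg).pow 2).add
    ((tendsto_iff_norm_sub_tendsto_zero.1 hf).pow 2)

theorem closureForm_coercive (u v : (closureForm Λ J 𝓒).domain) :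
    |(closureForm Λ J 𝓒).form1 u v| ≤
      1 * √((closureForm Λ J 𝓒).form1 u u * (closureForm Λ J 𝓒).form1 v v) := by
  rw [one_mul, closureForm_form1_self, closureForm_form1_self, closureForm_form1]
  refine Real.abs_le_sqrt ?_
  have h1 := abs_real_inner_le_norm (jumpGrad Λ J 𝓒 u) (jumpGrad Λ J 𝓒 v)
  have h2 := abs_real_inner_le_norm (u : Lp ℝ 2 Λ) v
  have h3 := (abs_add_le _ _).trans (add_le_add h1 h2)
  calc _ = |_| ^ 2 := (sq_abs _).symm
    _ ≤ _ := pow_le_pow_left₀ (abs_nonneg _) h3 2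
    -- Cauchy–Schwarz in the plane, by Lagrange's identity.
    _ ≤ _ := by nlinarith [sq_nonneg (‖jumpGrad Λ J 𝓒 u‖ * ‖(v : Lp ℝ 2 Λ)‖ -
        ‖jumpGrad Λ J 𝓒 v‖ * ‖(u : Lp ℝ 2 Λ)‖)]

end Graph

/-! ### Stability of the core under `C¹` functions -/

section StableComp

variable {E : Type*} {𝓒 : Submodule ℝ (E → ℝ)}

variable (𝓒) in
/-- `𝓒` is stable under composition with functions of class `C¹`. -/
def StableComp : Prop := ∀ u ∈ 𝓒, ∀ φ : ℝ → ℝ, ContDiff ℝ 1 φ → (fun x => φ (u x)) ∈ 𝓒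

theorem StableComp.const_mem (hC : StableComp 𝓒) (c : ℝ) : (fun _ => c) ∈ 𝓒 :=
  hC 0 𝓒.zero_mem (fun _ => c) contDiff_const

/-- Polarization: `uv = ((u + v)² - u² - v²) / 2`, and squaring is `C¹`. -/
theorem StableComp.mul_mem (hC : StableComp 𝓒) {u v : E → ℝ} (hu : u ∈ 𝓒) (hv : v ∈ 𝓒) :
    u * v ∈ 𝓒 := by
  have hsq (w) (hw : w ∈ 𝓒) : (fun x => w x ^ 2) ∈ 𝓒 :=
    hC w hw (fun s => s ^ 2) (contDiff_id.pow 2)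
  have h := 𝓒.smul_mem (1 / 2 : ℝ)
    (𝓒.sub_mem (𝓒.sub_mem (hsq _ (𝓒.add_mem hu hv)) (hsq u hu)) (hsq v hv))
  convert h using 1
  ext x
  simp only [Pi.mul_apply, Pi.smul_apply, Pi.sub_apply, Pi.add_apply, smul_eq_mul]
  ring

end StableComp

/-! ### Lattice and Markov properties of the domain -/

section Domain

variable {E : Type*} [MeasurableSpace E] {Λ : Measure E} {J : Measure (E × E)}
  {𝓒 : Submodule ℝ (E → ℝ)}

variable (Λ J 𝓒) in
/-- The class of `f` belongs to the domain of the closure. -/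
def MemDomain (f : E → ℝ) : Prop := ∃ q ∈ closedGraph Λ J 𝓒, q.1 =ᵐ[Λ] f

theorem MemDomain.of_core (h : FiniteEnergy Λ J 𝓒) {u : E → ℝ} (hu : u ∈ 𝓒) :
    MemDomain Λ J 𝓒 u :=
  ⟨_, graphPoint_mem hu (h u hu), (h u hu).1.coeFn_toLp⟩

theorem MemDomain.add {f g : E → ℝ} (hf : MemDomain Λ J 𝓒 f) (hg : MemDomain Λ J 𝓒 g) :
    MemDomain Λ J 𝓒 (f + g) := by
  obtain ⟨q, hq, h1⟩ := hf
  obtain ⟨r, hr, h2⟩ := hg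
  exact ⟨q + r, add_mem hq hr, (Lp.coeFn_add _ _).trans (h1.add h2)⟩

theorem MemDomain.smul {f : E → ℝ} (c : ℝ) (hf : MemDomain Λ J 𝓒 f) :
    MemDomain Λ J 𝓒 (c • f) := by
  obtain ⟨q, hq, h1⟩ := hf
  exact ⟨c • q, Submodule.smul_mem _ c hq, (Lp.coeFn_smul _ _).trans (h1.const_smul c)⟩

theorem MemDomain.neg {f : E → ℝ} (hf : MemDomain Λ J 𝓒 f) : MemDomain Λ J 𝓒 (-f) := by
  simpa using hf.smul (-1)

theorem MemDomain.sub {f g : E → ℝ} (hf : MemDomain Λ J 𝓒 f) (hg : MemDomain Λ J 𝓒 g) :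
    MemDomain Λ J 𝓒 (f - g) := by
  simpa [sub_eq_add_neg] using hf.add hg.neg

theorem MemDomain.memLp {f : E → ℝ} (hf : MemDomain Λ J 𝓒 f) : MemLp f 2 Λ := by
  obtain ⟨q, -, h1⟩ := hf
  exact (memLp_congr_ae h1).1 (Lp.memLp q.1)

theorem MemDomain.exists_graph [SFinite Λ] (hJ : J ≪ Λ.prod Λ) {f : E → ℝ}
    (hf : MemDomain Λ J 𝓒 f) :
    ∃ q ∈ closedGraph Λ J 𝓒, q.1 =ᵐ[Λ] f ∧ q.2 =ᵐ[J] jumpDiff f := by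
  obtain ⟨q, hq, h1⟩ := hf
  exact ⟨q, hq, h1, (closedGraph_ae hJ hq).trans (jumpDiff_congr_ae hJ h1)⟩

theorem MemDomain.memLp_jumpDiff [SFinite Λ] (hJ : J ≪ Λ.prod Λ) {f : E → ℝ}
    (hf : MemDomain Λ J 𝓒 f) : MemLp (jumpDiff f) 2 J := by
  obtain ⟨q, -, -, h2⟩ := hf.exists_graph hJ
  exact (memLp_congr_ae h2).1 (Lp.memLp q.2)

theorem tendsto_toLp_of_eLpNorm {α : Type*} [MeasurableSpace α] {μ : Measure α}
    {q : ℕ → Lp ℝ 2 μ} {F : ℕ → α → ℝ} {f : α → ℝ} (hf : MemLp f 2 μ)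
    (hq : ∀ n, q n =ᵐ[μ] F n) (h : Tendsto (fun n => eLpNorm (F n - f) 2 μ) atTop (𝓝 0)) :
    Tendsto q atTop (𝓝 (hf.toLp f)) := by
  rw [Lp.tendsto_Lp_iff_tendsto_eLpNorm]
  exact h.congr fun n => eLpNorm_congr_ae ((hq n).symm.sub EventuallyEq.rfl)

/-- The domain is closed under `L²`-convergence of functions together with their differences. -/
theorem MemDomain.of_tendsto [SFinite Λ] (hJ : J ≪ Λ.prod Λ) {F : ℕ → E → ℝ} {f : E → ℝ}
    (hF : ∀ n, MemDomain Λ J 𝓒 (F n)) (hf : MemLp f 2 Λ) (hf' : MemLp (jumpDiff f) 2 J)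
    (h1 : Tendsto (fun n => eLpNorm (F n - f) 2 Λ) atTop (𝓝 0))
    (h2 : Tendsto (fun n => eLpNorm (jumpDiff (F n) - jumpDiff f) 2 J) atTop (𝓝 0)) :
    MemDomain Λ J 𝓒 f := by
  choose q hq hq1 hq2 using fun n => (hF n).exists_graph hJ
  exact ⟨(hf.toLp f, hf'.toLp (jumpDiff f)), isClosed_closedGraph.mem_of_tendsto
    ((tendsto_toLp_of_eLpNorm hf hq1 h1).prodMk_nhds (tendsto_toLp_of_eLpNorm hf' hq2 h2))
    (Eventually.of_forall hq), hf.coeFn_toLp⟩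

/-- Dominated convergence with a moving error term: `|H n| ≤ min |H n| |G| + |D n|`, where the
minimum is dominated by `|G|` and `D n` vanishes in `L²`. -/
theorem tendsto_eLpNorm_zero_of_le_add {α : Type*} [MeasurableSpace α] {μ : Measure α}
    {H D : ℕ → α → ℝ} {G : α → ℝ} (hH : ∀ n, AEStronglyMeasurable (H n) μ)
    (hD : ∀ n, AEStronglyMeasurable (D n) μ) (hG : MemLp G 2 μ)
    (bound : ∀ n x, |H n x| ≤ |D n x| + |G x|)
    (hD0 : Tendsto (fun n => eLpNorm (D n) 2 μ) atTop (𝓝 0))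
    (lim : ∀ᵐ x ∂μ, Tendsto (fun n => H n x) atTop (𝓝 0)) :
    Tendsto (fun n => eLpNorm (H n) 2 μ) atTop (𝓝 0) := by
  have hr (n) : AEStronglyMeasurable (fun x => min |H n x| |G x|) μ :=
    (hH n).norm.inf hG.1.norm
  have h1 : Tendsto (fun n => eLpNorm (fun x => min |H n x| |G x|) 2 μ) atTop (𝓝 0) := by
    refine tendsto_eLpNorm_zero_of_dominated hr hG.abs (fun n => ?_) ?_
    · refine Eventually.of_forall fun x => ?_
      rw [abs_of_nonneg (by positivity)]
      exact min_le_right _ _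
    · filter_upwards [lim] with x hx
      have := (hx.abs).min (tendsto_const_nhds (x := |G x|))
      simpa using this
  have h2 := h1.add hD0
  rw [add_zero] at h2
  refine tendsto_of_tendsto_of_tendsto_of_le_of_le tendsto_const_nhds h2 (fun _ => zero_le)
    fun n => ?_
  refine le_trans (eLpNorm_mono_real (g := fun x => min |H n x| |G x| + |D n x|) fun x => ?_) ?_
  · rw [Real.norm_eq_abs]
    rcases le_total |H n x| |G x| with h | h
    · simp [h]
    · rw [min_eq_right h, add_comm]; exact bound n x
  · refine (eLpNorm_add_le (hr n) (hD n).norm (by norm_num)).trans_eq ?_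
    rw [← eLpNorm_norm (D n)]

theorem sqrt_sq_add_sub_le {c : ℝ} (hc : 0 ≤ c) (a b : ℝ) :
    √(a ^ 2 + c) - √(b ^ 2 + c) ≤ |a - b| := by
  have h0 : |b| ≤ √(b ^ 2 + c) := Real.abs_le_sqrt (by linarith)
  have h1 : |a| ≤ |b| + |a - b| := by have := abs_add_le b (a - b); simpa using this
  have h2 := Real.sq_sqrt (show 0 ≤ b ^ 2 + c by positivity)
  rw [sub_le_iff_le_add]
  refine Real.sqrt_le_iff.2 ⟨by positivity, ?_⟩
  have h3 : a ^ 2 ≤ (|b| + |a - b|) ^ 2 := by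
    rw [← sq_abs a]; exact pow_le_pow_left₀ (abs_nonneg _) h1 2
  have h4 := mul_le_mul_of_nonneg_left h0 (abs_nonneg (a - b))
  nlinarith [sq_abs b]

theorem abs_sqrt_sq_add_sub_le {c : ℝ} (hc : 0 ≤ c) (a b : ℝ) :
    |√(a ^ 2 + c) - √(b ^ 2 + c)| ≤ |a - b| := by
  refine abs_le.2 ⟨?_, sqrt_sq_add_sub_le hc a b⟩
  have := sqrt_sq_add_sub_le hc b a
  rw [abs_sub_comm] at this
  linarith

theorem abs_sqrt_sq_add_sub_abs_le {c : ℝ} (hc : 0 ≤ c) (a : ℝ) :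
    |(√(a ^ 2 + c) - |a|)| ≤ √c := by
  have h0 : |a| ≤ √(a ^ 2 + c) := Real.abs_le_sqrt (by linarith)
  rw [abs_of_nonneg (by linarith), sub_le_iff_le_add]
  refine Real.sqrt_le_iff.2 ⟨by positivity, ?_⟩
  nlinarith [Real.sq_sqrt hc, sq_abs a, mul_nonneg (Real.sqrt_nonneg c) (abs_nonneg a)]

/-- The absolute value is not `C¹`, so it is replaced by `s ↦ √(s² + c)` with `c → 0`. These maps
are 1-Lipschitz, hence do not enlarge differences, and strong convergence in both `L²` spaces
follows from dominated convergence. -/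
theorem MemDomain.abs [IsFiniteMeasure Λ] (hJ : J ≪ Λ.prod Λ) (h : FiniteEnergy Λ J 𝓒)
    (hC : StableComp 𝓒) {f : E → ℝ} (hf : MemDomain Λ J 𝓒 f) :
    MemDomain Λ J 𝓒 (fun x => |f x|) := by
  obtain ⟨q, hq, hq1, hq2⟩ := hf.exists_graph hJ
  obtain ⟨u, hu, hlim⟩ := exists_seq_of_mem_closedGraph h hq
  have hfL := hf.memLp
  have hfJ := hf.memLp_jumpDiff hJ
  have e1 : hfL.toLp f = q.1 := Lp.ext (hfL.coeFn_toLp.trans hq1.symm)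
  have e2 : hfJ.toLp (jumpDiff f) = q.2 := Lp.ext (hfJ.coeFn_toLp.trans hq2.symm)
  have l1 : Tendsto (fun n => (h _ (hu n)).1.toLp (u n)) atTop (𝓝 (hfL.toLp f)) :=
    e1 ▸ (continuous_fst.tendsto q).comp hlim
  have l2 : Tendsto (fun n => (h _ (hu n)).2.toLp (jumpDiff (u n))) atTop
      (𝓝 (hfJ.toLp (jumpDiff f))) := e2 ▸ (continuous_snd.tendsto q).comp hlim
  obtain ⟨ns, hns, hae⟩ := exists_subseq_ae l1
  replace l1 := (Lp.tendsto_Lp_iff_tendsto_eLpNorm'' _ (fun n => (h _ (hu (ns n))).1) _ _).1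
    (l1.comp hns.tendsto_atTop)
  replace l2 := (Lp.tendsto_Lp_iff_tendsto_eLpNorm'' _ (fun n => (h _ (hu (ns n))).2) _ _).1
    (l2.comp hns.tendsto_atTop)
  have hae' : ∀ᵐ x ∂Λ, Tendsto (fun i => u (ns i) x) atTop (𝓝 (f x)) := by
    filter_upwards [hae, hfL.coeFn_toLp,
      ae_all_iff.2 fun n => (h _ (hu n)).1.coeFn_toLp] with x h1 h2 h3
    rw [h2] at h1
    exact h1.congr fun i => h3 _
  have hc (i : ℕ) : 0 < (1 : ℝ) / (i + 1) := Nat.one_div_pos_of_nat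
  let w : ℕ → E → ℝ := fun i x => √(u (ns i) x ^ 2 + 1 / ((i : ℝ) + 1))
  have hw (i) : w i ∈ 𝓒 := hC _ (hu (ns i)) (fun s => √(s ^ 2 + 1 / ((i : ℝ) + 1)))
    (ContDiff.sqrt (by fun_prop) fun s => (add_pos_of_nonneg_of_pos (sq_nonneg s) (hc i)).ne')
  have hwae : ∀ᵐ x ∂Λ, Tendsto (fun i => w i x) atTop (𝓝 |f x|) := by
    filter_upwards [hae'] with x hx
    have := ((hx.pow 2).add (tendsto_one_div_add_atTop_nhds_zero_nat (𝕜 := ℝ))).sqrt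
    rwa [add_zero, Real.sqrt_sq_eq_abs] at this
  have habs : MemLp (fun x => |f x|) 2 Λ := hfL.abs
  have hΔ (p : E × E) : |jumpDiff (fun x => |f x|) p| ≤ |jumpDiff f p| :=
    abs_abs_sub_abs_le_abs_sub _ _
  have habsJ : MemLp (jumpDiff fun x => |f x|) 2 J := by
    refine hfJ.mono ?_ (Eventually.of_forall hΔ)
    -- `f` is only a.e. measurable, so measurability of the difference on the product is obtained
    -- from a strongly measurable representative.
    have hm : (fun x => |hfL.1.mk f x|) =ᵐ[Λ] fun x => |f x| := by
      filter_upwards [hfL.1.ae_eq_mk] with x hx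
      rw [hx]
    refine AEStronglyMeasurable.congr ?_ (jumpDiff_congr_ae hJ hm)
    have hs : StronglyMeasurable fun x => |hfL.1.mk f x| := hfL.1.stronglyMeasurable_mk.norm
    exact ((hs.comp_measurable measurable_fst).sub
      (hs.comp_measurable measurable_snd)).aestronglyMeasurable
  refine MemDomain.of_tendsto hJ (fun i => MemDomain.of_core h (hw i)) habs habsJ ?_ ?_
  -- The constant `1` bounds the smoothing error `√(1/(i+1))`.
  · refine tendsto_eLpNorm_zero_of_le_add (D := fun i => u (ns i) - f) (G := fun _ => 1)
      (fun i => (h _ (hw i)).1.1.sub habs.1) (fun i => (h _ (hu _)).1.1.sub hfL.1)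
      (memLp_const 1) (fun i x => ?_) l1 ?_
    · have h1 := abs_sqrt_sq_add_sub_abs_le (hc i).le (u (ns i) x)
      have h2 : √((1 : ℝ) / (i + 1)) ≤ 1 := by
        refine Real.sqrt_le_iff.2 ⟨zero_le_one, ?_⟩
        exact (Nat.one_div_le_one_div (Nat.zero_le i)).trans (by norm_num)
      have h3 := abs_abs_sub_abs_le_abs_sub (u (ns i) x) (f x)
      have h4 := abs_add_le (w i x - |u (ns i) x|) (|u (ns i) x| - |f x|)
      rw [sub_add_sub_cancel] at h4
      simp only [Pi.sub_apply, abs_one]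
      linarith
    · filter_upwards [hwae] with x hx
      simpa using hx.sub_const |f x|
  -- One copy of `|jumpDiff f|` bounds the difference of `|f|`, the other comes from splitting
  -- `jumpDiff (u (ns i))` as error plus limit.
  · refine tendsto_eLpNorm_zero_of_le_add (D := fun i => jumpDiff (u (ns i)) - jumpDiff f)
      (G := fun p => 2 * jumpDiff f p)
      (fun i => (h _ (hw i)).2.1.sub habsJ.1) (fun i => (h _ (hu _)).2.1.sub hfJ.1)
      (hfJ.const_mul 2) (fun i p => ?_) l2 ?_
    · have h1 : |jumpDiff (w i) p| ≤ |jumpDiff (u (ns i)) p| :=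
        abs_sqrt_sq_add_sub_le (hc i).le _ _
      have h2 := hΔ p
      have h3 := abs_sub (jumpDiff (w i) p) (jumpDiff (fun x => |f x|) p)
      have h4 := abs_add_le (jumpDiff (u (ns i)) p - jumpDiff f p) (jumpDiff f p)
      rw [sub_add_cancel] at h4
      simp only [Pi.sub_apply, abs_mul, abs_two]
      linarith
    · filter_upwards [ae_fst_snd hJ hwae] with p hp
      have := (hp.1.sub hp.2).sub_const (|f p.1| - |f p.2|)
      simpa [jumpDiff] using this

theorem MemDomain.sup [IsFiniteMeasure Λ] (hJ : J ≪ Λ.prod Λ) (h : FiniteEnergy Λ J 𝓒)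
    (hC : StableComp 𝓒) {f g : E → ℝ} (hf : MemDomain Λ J 𝓒 f) (hg : MemDomain Λ J 𝓒 g) :
    MemDomain Λ J 𝓒 (f ⊔ g) := by
  have h1 := ((hf.add hg).add ((hf.sub hg).abs hJ h hC)).smul (1 / 2)
  convert h1 using 1
  ext x
  simp only [Pi.sup_apply, Pi.smul_apply, Pi.add_apply, Pi.sub_apply, smul_eq_mul]
  rw [max_def]
  split_ifs with hx
  · rw [abs_of_nonpos (by linarith)]; ring
  · rw [abs_of_nonneg (by linarith)]; ring

theorem MemDomain.clip [IsFiniteMeasure Λ] (hJ : J ≪ Λ.prod Λ) (h : FiniteEnergy Λ J 𝓒)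
    (hC : StableComp 𝓒) {f : E → ℝ} (hf : MemDomain Λ J 𝓒 f) :
    MemDomain Λ J 𝓒 (fun x => min (max (f x) 0) 1) := by
  have hc (c : ℝ) : MemDomain Λ J 𝓒 (fun _ => c) := .of_core h (hC.const_mem c)
  have h1 := ((hf.sup hJ h hC (hc 0)).neg.sup hJ h hC (hc (-1))).neg
  convert h1 using 1
  ext x
  simp only [Pi.neg_apply, Pi.sup_apply]
  rw [max_neg_neg, neg_neg]

theorem MemDomain.exists_lift {f : E → ℝ} (hf : MemDomain Λ J 𝓒 f) :
    ∃ w : (closureForm Λ J 𝓒).domain, (w : Lp ℝ 2 Λ) =ᵐ[Λ] f := by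
  obtain ⟨q, hq, h1⟩ := hf
  exact ⟨⟨q.1, mem_closureForm_domain.2 ⟨q.2, hq⟩⟩, h1⟩

theorem jumpGrad_ae [SFinite Λ] (hJ : J ≪ Λ.prod Λ) (w : (closureForm Λ J 𝓒).domain) :
    jumpGrad Λ J 𝓒 w =ᵐ[J] jumpDiff (w : Lp ℝ 2 Λ) :=
  closedGraph_ae hJ (jumpGrad_mem hJ w)

/-- Clipping to `[0, 1]` is 1-Lipschitz, so differences shrink pointwise and with them the energy.
-/
theorem closureForm_markov [IsFiniteMeasure Λ] (hJ : J ≪ Λ.prod Λ) (h : FiniteEnergy Λ J 𝓒)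
    (hC : StableComp 𝓒) (u : (closureForm Λ J 𝓒).domain) :
    ∃ w : (closureForm Λ J 𝓒).domain,
    ((w : Lp ℝ 2 Λ) : E → ℝ) =ᵐ[Λ] (fun x => min (max ((u : Lp ℝ 2 Λ) x) 0) 1) ∧
      (closureForm Λ J 𝓒).form w w ≤ (closureForm Λ J 𝓒).form u u := by
  have hu : MemDomain Λ J 𝓒 (u : Lp ℝ 2 Λ) := ⟨_, jumpGrad_mem hJ u, EventuallyEq.rfl⟩
  obtain ⟨w, hw⟩ := (hu.clip hJ h hC).exists_lift
  refine ⟨w, hw, ?_⟩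
  rw [closureForm_form, closureForm_form, real_inner_self_eq_norm_sq, real_inner_self_eq_norm_sq]
  refine pow_le_pow_left₀ (norm_nonneg _) (Lp.norm_le_norm_of_ae_le ?_) 2
  filter_upwards [jumpGrad_ae hJ w, jumpGrad_ae hJ u, jumpDiff_congr_ae hJ hw] with p h1 h2 h3
  rw [h1, h2, h3, Real.norm_eq_abs, Real.norm_eq_abs]
  refine (abs_min_sub_min_le_max _ _ _ _).trans (max_le ?_ (by simp))
  exact (abs_max_sub_max_le_max _ _ _ _).trans (max_le le_rfl (by simp))

end Domain

/-! ### Abstract cores and uniformly bounded Lipschitz functions -/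

section Core

variable {E : Type*}

theorem partialSups_induction {P : (E → ℝ) → Prop} (hsup : ∀ f g, P f → P g → P (f ⊔ g))
    {f : ℕ → E → ℝ} (hf : ∀ n, P (f n)) (n : ℕ) : P (partialSups f n) := by
  induction n with
  | zero => simpa using hf 0
  | succ n ih => simpa [partialSups_add_one] using hsup _ _ ih (hf _)

variable [MetricSpace E]

/-- A space of bounded Lipschitz functions, stable under composition with functions of class `C¹`,
from which the distance to every point can be recovered. -/
structure LipschitzCore (𝓒 : Submodule ℝ (E → ℝ)) : Prop where
  bound : ∀ u ∈ 𝓒, ∃ C : ℝ, (∀ x, |u x| ≤ C) ∧ ∀ x y, |u x - u y| ≤ C * min 1 (dist x y)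
  comp : StableComp 𝓒
  approx_dist : ∀ ν μ : E, ∀ ε > 0, ∃ g ∈ 𝓒, (∀ x, |g x| ≤ 2) ∧
    (∀ x y, |g x - g y| ≤ dist x y) ∧ (∀ x, g x ≤ Real.arctan (dist x ν)) ∧
    Real.arctan (dist μ ν) - ε < g μ

theorem LipschitzCore.continuous {𝓒 : Submodule ℝ (E → ℝ)} (hC : LipschitzCore 𝓒) {u : E → ℝ}
    (hu : u ∈ 𝓒) : Continuous u := by
  obtain ⟨C, h0, hC⟩ := hC.bound u hu
  refine (LipschitzWith.of_dist_le_mul (K := C.toNNReal) fun x y => ?_).continuous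
  have hC0 : 0 ≤ C := (abs_nonneg _).trans (h0 x)
  rw [Real.coe_toNNReal C hC0, Real.dist_eq]
  exact (hC x y).trans (mul_le_mul_of_nonneg_left (min_le_right _ _) hC0)

/-- The functions that are bounded by `2` and `1`-Lipschitz. -/
def BddLip (f : E → ℝ) : Prop := (∀ x, |f x| ≤ 2) ∧ ∀ x y, |f x - f y| ≤ dist x y

theorem BddLip.continuous {f : E → ℝ} (hf : BddLip f) : Continuous f :=
  (LipschitzWith.of_dist_le_mul (K := 1) fun x y => by
    simpa [Real.dist_eq] using hf.2 x y).continuous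

theorem BddLip.neg {f : E → ℝ} (hf : BddLip f) : BddLip (-f) := by
  refine ⟨fun x => by simpa using hf.1 x, fun x y => ?_⟩
  rw [Pi.neg_apply, Pi.neg_apply, neg_sub_neg, dist_comm]
  exact hf.2 y x

theorem BddLip.sup {f g : E → ℝ} (hf : BddLip f) (hg : BddLip g) : BddLip (f ⊔ g) := by
  refine ⟨fun x => ?_, fun x y => ?_⟩
  · exact (abs_max_le_max_abs_abs).trans (max_le (hf.1 x) (hg.1 x))
  · exact (abs_max_sub_max_le_max _ _ _ _).trans (max_le (hf.2 x y) (hg.2 x y))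

theorem BddLip.of_tendsto {F : ℕ → E → ℝ} {f : E → ℝ} (hF : ∀ n, BddLip (F n))
    (h : ∀ x, Tendsto (fun n => F n x) atTop (𝓝 (f x))) : BddLip f :=
  ⟨fun x => le_of_tendsto' (h x).abs fun n => (hF n).1 x,
    fun x y => le_of_tendsto' ((h x).sub (h y)).abs fun n => (hF n).2 x y⟩

theorem BddLip.jumpDiff_le {f : E → ℝ} (hf : BddLip f) (x y : E) :
    |f x - f y| ≤ 4 * min 1 (dist x y) := by
  have h1 := hf.2 x y
  have h2 := abs_sub (f x) (f y)
  have h3 := hf.1 x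
  have h4 := hf.1 y
  have hd : 0 ≤ dist x y := dist_nonneg
  rcases le_total 1 (dist x y) with h | h
  · rw [min_eq_left h]; linarith
  · rw [min_eq_right h]; linarith

theorem abs_arctan_le_two (s : ℝ) : |Real.arctan s| ≤ 2 := by
  have h1 := Real.arctan_lt_pi_div_two s
  have h2 := Real.neg_pi_div_two_lt_arctan s
  have h3 := Real.pi_lt_four
  exact abs_le.2 ⟨by linarith, by linarith⟩

theorem abs_arctan_sub_arctan_le (s t : ℝ) : |Real.arctan s - Real.arctan t| ≤ |s - t| := by
  have h : LipschitzWith 1 Real.arctan := by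
    refine lipschitzWith_of_nnnorm_deriv_le Real.differentiable_arctan fun x => ?_
    rw [← NNReal.coe_le_coe, coe_nnnorm, Real.deriv_arctan, Real.norm_eq_abs,
      abs_of_nonneg (by positivity)]
    exact div_le_one_of_le₀ (by nlinarith [sq_nonneg x]) (by positivity)
  simpa [Real.dist_eq] using h.dist_le_mul s t

/-- The bounded distance `arctan (dist x ν)` to the point `ν`. -/
def arctanDist (ν x : E) : ℝ := Real.arctan (dist x ν)

theorem arctanDist_bddLip (ν : E) : BddLip (arctanDist ν) :=
  ⟨fun _ => abs_arctan_le_two _, fun x y =>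
    (abs_arctan_sub_arctan_le _ _).trans (abs_dist_sub_le x y ν)⟩

theorem arctanDist_nonneg (ν x : E) : 0 ≤ arctanDist ν x := Real.arctan_nonneg.2 dist_nonneg

end Core

/-! ### Distance functions in the domain, density, Dirichlet property -/

section Metric

variable {E : Type*} [MetricSpace E] [MeasurableSpace E] [BorelSpace E]
  {Λ : Measure E} {J : Measure (E × E)}
  {𝓒 : Submodule ℝ (E → ℝ)}

theorem BddLip.memLp [IsFiniteMeasure Λ] {f : E → ℝ} (hf : BddLip f) : MemLp f 2 Λ :=
  .of_bound hf.continuous.aestronglyMeasurable 2 (Eventually.of_forall hf.1)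

variable [SecondCountableTopology E]

theorem memLp_min_dist (hJ1 : ∫⁻ p, ENNReal.ofReal (min 1 (dist p.1 p.2 ^ 2)) ∂J < ∞) :
    MemLp (fun p : E × E => min 1 (dist p.1 p.2)) 2 J := by
  have hm : Continuous fun p : E × E => min 1 (dist p.1 p.2) := by fun_prop
  rw [memLp_two_iff_integrable_sq hm.aestronglyMeasurable]
  refine ⟨(hm.pow 2).aestronglyMeasurable, ?_⟩
  rw [hasFiniteIntegral_iff_ofReal (Eventually.of_forall fun p => sq_nonneg _)]
  refine (lintegral_congr fun p => ?_).trans_lt hJ1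
  congr 1
  have hd : 0 ≤ dist p.1 p.2 := dist_nonneg
  rcases le_total 1 (dist p.1 p.2) with h1 | h1
  · rw [min_eq_left h1, min_eq_left (by nlinarith)]; norm_num
  · rw [min_eq_right h1, min_eq_right (by nlinarith)]

theorem memLp_jumpDiff_of_le (hJ1 : ∫⁻ p, ENNReal.ofReal (min 1 (dist p.1 p.2 ^ 2)) ∂J < ∞)
    {f : E → ℝ} (hf : Continuous f) {C : ℝ} (h : ∀ x y, |f x - f y| ≤ C * min 1 (dist x y)) :
    MemLp (jumpDiff f) 2 J := by
  refine ((memLp_min_dist hJ1).const_mul C).mono ?_ (Eventually.of_forall fun p => ?_)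
  · have : Continuous (jumpDiff f) := by unfold jumpDiff; fun_prop
    exact this.aestronglyMeasurable
  · exact (h p.1 p.2).trans (le_abs_self _)

theorem LipschitzCore.finiteEnergy [IsFiniteMeasure Λ] (hC : LipschitzCore 𝓒)
    (hJ1 : ∫⁻ p, ENNReal.ofReal (min 1 (dist p.1 p.2 ^ 2)) ∂J < ∞) : FiniteEnergy Λ J 𝓒 := by
  intro u hu
  obtain ⟨C, h0, h1⟩ := hC.bound u hu
  exact ⟨.of_bound (hC.continuous hu).aestronglyMeasurable C (Eventually.of_forall h0),
    memLp_jumpDiff_of_le hJ1 (hC.continuous hu) h1⟩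

theorem BddLip.memLp_jumpDiff
    (hJ1 : ∫⁻ p, ENNReal.ofReal (min 1 (dist p.1 p.2 ^ 2)) ∂J < ∞) {f : E → ℝ}
    (hf : BddLip f) : MemLp (jumpDiff f) 2 J :=
  memLp_jumpDiff_of_le hJ1 hf.continuous hf.jumpDiff_le

/-- For this class pointwise convergence suffices: the constant `4` and `8 min(1, dist)` dominate,
being twice the uniform bounds on values and on differences. -/
theorem BddLip.tendsto_eLpNorm [IsFiniteMeasure Λ]
    (hJ1 : ∫⁻ p, ENNReal.ofReal (min 1 (dist p.1 p.2 ^ 2)) ∂J < ∞) {F : ℕ → E → ℝ} {f : E → ℝ}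
    (hF : ∀ n, BddLip (F n)) (h : ∀ x, Tendsto (fun n => F n x) atTop (𝓝 (f x))) :
    Tendsto (fun n => eLpNorm (F n - f) 2 Λ) atTop (𝓝 0) ∧
      Tendsto (fun n => eLpNorm (jumpDiff (F n) - jumpDiff f) 2 J) atTop (𝓝 0) := by
  have hf := BddLip.of_tendsto hF h
  constructor
  · refine tendsto_eLpNorm_zero_of_dominated (G := fun _ => 4)
      (fun n => (hF n).memLp.1.sub hf.memLp.1) (memLp_const 4)
      (fun n => Eventually.of_forall fun x => ?_) (Eventually.of_forall fun x => ?_)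
    · have h2 := abs_sub (F n x) (f x)
      have h3 := (hF n).1 x
      have h4 := hf.1 x
      simp only [Pi.sub_apply]
      linarith
    · simpa using (h x).sub_const (f x)
  · refine tendsto_eLpNorm_zero_of_dominated
      (fun n => ((hF n).memLp_jumpDiff hJ1).1.sub (hf.memLp_jumpDiff hJ1).1)
      ((memLp_min_dist hJ1).const_mul 8)
      (fun n => Eventually.of_forall fun p => ?_) (Eventually.of_forall fun p => ?_)
    · have h2 := abs_sub (jumpDiff (F n) p) (jumpDiff f p)
      have h3 := (hF n).jumpDiff_le p.1 p.2
      have h4 := hf.jumpDiff_le p.1 p.2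
      simp only [Pi.sub_apply]
      unfold jumpDiff at *
      linarith
    · simpa [jumpDiff] using ((h p.1).sub (h p.2)).sub_const (f p.1 - f p.2)

theorem MemDomain.of_tendsto_bddLip [IsFiniteMeasure Λ] (hJ : J ≪ Λ.prod Λ)
    (hJ1 : ∫⁻ p, ENNReal.ofReal (min 1 (dist p.1 p.2 ^ 2)) ∂J < ∞) {F : ℕ → E → ℝ} {f : E → ℝ}
    (hD : ∀ n, MemDomain Λ J 𝓒 (F n)) (hF : ∀ n, BddLip (F n))
    (h : ∀ x, Tendsto (fun n => F n x) atTop (𝓝 (f x))) : MemDomain Λ J 𝓒 f := by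
  have hf := BddLip.of_tendsto hF h
  have := BddLip.tendsto_eLpNorm (Λ := Λ) hJ1 hF h
  exact .of_tendsto hJ hD hf.memLp (hf.memLp_jumpDiff hJ1) this.1 this.2

/-- The bounded distance to a point belongs to the domain. -/
theorem LipschitzCore.memDomain_arctanDist [IsFiniteMeasure Λ] (hC : LipschitzCore 𝓒)
    (hJ : J ≪ Λ.prod Λ)
    (hJ1 : ∫⁻ p, ENNReal.ofReal (min 1 (dist p.1 p.2 ^ 2)) ∂J < ∞) (ν : E) :
    MemDomain Λ J 𝓒 (arctanDist ν) := by
  have : Nonempty E := ⟨ν⟩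
  have hE : FiniteEnergy Λ J 𝓒 := hC.finiteEnergy hJ1
  let x := TopologicalSpace.denseSeq E
  -- `g k n` lies below the target everywhere and is within `1/(n+1)` of it at the dense point `x
  -- k`.
  choose g hg hg2 hgl hgle hgt using
    fun k n : ℕ => hC.approx_dist ν (x k) (1 / ((n : ℝ) + 1)) Nat.one_div_pos_of_nat
  let G : ℕ → E → ℝ := fun n => partialSups (fun k => g k n) n
  have hGd (n) : MemDomain Λ J 𝓒 (G n) :=
    partialSups_induction (fun f g hf hg => hf.sup hJ hE hC.comp hg)
      (fun k => .of_core hE (hg k n)) n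
  have hGl (n) : BddLip (G n) :=
    partialSups_induction (fun f g hf hg => hf.sup hg) (fun k => ⟨hg2 k n, hgl k n⟩) n
  refine .of_tendsto_bddLip hJ hJ1 hGd hGl fun μ => ?_
  rw [Metric.tendsto_atTop]
  intro ε hε
  -- Three errors of at most `ε/4`: moving the target to `x k`, the defect of `g k n` there, and
  -- moving `g k n` back to `μ`.
  obtain ⟨k, hk⟩ := (TopologicalSpace.denseRange_denseSeq E).exists_dist_lt μ
    (show 0 < ε / 4 by positivity)
  obtain ⟨N, hN⟩ := exists_nat_one_div_lt (show 0 < ε / 4 by positivity)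
  refine ⟨max k N, fun n hn => ?_⟩
  have h1 : G n μ ≤ arctanDist ν μ :=
    (partialSups_le (fun k => g k n) n (arctanDist ν) fun k _ => hgle k n) μ
  have h2 : g k n μ ≤ G n μ := le_partialSups_of_le (fun k => g k n) (le_of_max_le_left hn) μ
  have h3 := hgt k n
  have h4 : 1 / ((n : ℝ) + 1) ≤ 1 / ((N : ℝ) + 1) :=
    Nat.one_div_le_one_div (le_of_max_le_right hn)
  have h5 := (abs_le.1 ((hgl k n) μ (x k))).1
  have h6 := (abs_le.1 ((arctanDist_bddLip ν).2 μ (x k))).2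
  change arctanDist ν (x k) - _ < _ at h3
  change dist μ (x k) < _ at hk
  rw [Real.dist_eq, abs_lt]
  constructor <;> linarith

/-- The core is dense in `L²`. -/
theorem LipschitzCore.dense_domain [CompleteSpace E] [IsFiniteMeasure Λ] (hC : LipschitzCore 𝓒)
    (hJ1 : ∫⁻ p, ENNReal.ofReal (min 1 (dist p.1 p.2 ^ 2)) ∂J < ∞) :
    Dense ((closureForm Λ J 𝓒).domain : Set (Lp ℝ 2 Λ)) := by
  have hE : FiniteEnergy Λ J 𝓒 := hC.finiteEnergy hJ1
  rw [Submodule.dense_iff_topologicalClosure_eq_top, Submodule.topologicalClosure_eq_top_iff,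
    Submodule.eq_bot_iff]
  intro g hg
  have hgi : Integrable (g : E → ℝ) Λ := (Lp.memLp g).integrable (by norm_num)
  have horth (u : E → ℝ) (hu : u ∈ 𝓒) : ∫ x, g x * u x ∂Λ = 0 := by
    have h1 := hg _ (mem_closureForm_domain.2 ⟨_, graphPoint_mem hu (hE u hu)⟩)
    rw [L2.inner_def] at h1
    rw [← h1]
    refine integral_congr_ae ?_
    filter_upwards [(hE u hu).1.coeFn_toLp] with x hx
    simp [hx]
  have hgm : AEMeasurable (fun x => ENNReal.ofReal (g x)) Λ := hgi.1.aemeasurable.ennreal_ofReal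
  have hgm' : AEMeasurable (fun x => ENNReal.ofReal (-g x)) Λ :=
    hgi.1.aemeasurable.neg.ennreal_ofReal
  have hfin : ∫⁻ x, ENNReal.ofReal (g x) ∂Λ ≠ ∞ := (hgi.lintegral_lt_top).ne
  have hfin' : ∫⁻ x, ENNReal.ofReal (-g x) ∂Λ ≠ ∞ := (hgi.neg.lintegral_lt_top).ne
  have := isFiniteMeasure_withDensity hfin
  have := isFiniteMeasure_withDensity hfin'
  -- For `g` orthogonal to the core, the finite measures `g⁺Λ` and `g⁻Λ` agree on this
  -- point-separating algebra. On a Polish space they are then equal, which forces `g = 0`.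
  let A : StarSubalgebra ℝ (BoundedContinuousFunction E ℝ) :=
    { carrier := {u | (u : E → ℝ) ∈ 𝓒}
      mul_mem' := fun {u v} hu hv => hC.comp.mul_mem hu hv
      add_mem' := fun {u v} hu hv => 𝓒.add_mem hu hv
      algebraMap_mem' := fun c => hC.comp.const_mem c
      star_mem' := fun {u} hu => by simpa using hu }
  have hsep : (A.map (BoundedContinuousFunction.toContinuousMapStarₐ ℝ)).SeparatesPoints := by
    intro x y hxy
    have hpos : 0 < Real.arctan (dist x y) := by
      rw [Real.arctan_pos]; exact dist_pos.2 hxy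
    -- With tolerance `arctan (dist x y)` this gives `g y ≤ 0 < g x`.
    obtain ⟨g, hg, hg2, -, hgle, hgt⟩ := hC.approx_dist y x _ hpos
    let g' : BoundedContinuousFunction E ℝ :=
      BoundedContinuousFunction.ofNormedAddCommGroup g (hC.continuous hg) 2 hg2
    refine ⟨g, ⟨_, ⟨g', hg, rfl⟩, rfl⟩, fun h => ?_⟩
    have h1 := hgle y
    rw [dist_self, Real.arctan_zero] at h1
    rw [h] at hgt
    linarith
  have key := ext_of_forall_mem_subalgebra_integral_eq_of_polish
    (P := Λ.withDensity fun x => ENNReal.ofReal (g x))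
    (P' := Λ.withDensity fun x => ENNReal.ofReal (-g x)) hsep (fun u hu => by
      rw [integral_withDensity_eq_integral_toReal_smul₀ hgm
          (Eventually.of_forall fun _ => ENNReal.ofReal_lt_top),
        integral_withDensity_eq_integral_toReal_smul₀ hgm'
          (Eventually.of_forall fun _ => ENNReal.ofReal_lt_top), ← sub_eq_zero, ← integral_sub]
      · rw [← horth u hu]
        congr 1 with x
        rw [ENNReal.toReal_ofReal', ENNReal.toReal_ofReal', ← sub_smul, smul_eq_mul]
        congr 1
        rcases le_total 0 (g x) with h | h
        · rw [max_eq_left h, max_eq_right (by linarith)]; ring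
        · rw [max_eq_right h, max_eq_left (by linarith)]; ring
      · have h1 : Integrable (fun x => (ENNReal.ofReal (g x)).toReal) Λ :=
          integrable_toReal_of_lintegral_ne_top hgm hfin
        exact h1.mul_bdd (c := ‖u‖) u.continuous.aestronglyMeasurable
          (Eventually.of_forall u.norm_coe_le_norm)
      · have h1 : Integrable (fun x => (ENNReal.ofReal (-g x)).toReal) Λ :=
          integrable_toReal_of_lintegral_ne_top hgm' hfin'
        exact h1.mul_bdd (c := ‖u‖) u.continuous.aestronglyMeasurable
          (Eventually.of_forall u.norm_coe_le_norm))
  rw [withDensity_eq_iff hgm hgm' hfin] at key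
  refine Lp.ext ?_
  filter_upwards [key, Lp.coeFn_zero ℝ 2 Λ] with x hx h0
  rw [h0, Pi.zero_apply]
  rcases lt_trichotomy (g x) 0 with h | h | h
  · rw [ENNReal.ofReal_of_nonpos h.le, eq_comm, ENNReal.ofReal_eq_zero] at hx
    linarith
  · exact h
  · rw [ENNReal.ofReal_of_nonpos (p := -g x) (by linarith), ENNReal.ofReal_eq_zero] at hx
    linarith

theorem LipschitzCore.isDirichlet [CompleteSpace E] [IsProbabilityMeasure Λ]
    (hC : LipschitzCore 𝓒) (hJ : J ≪ Λ.prod Λ)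
    (hJ1 : ∫⁻ p, ENNReal.ofReal (min 1 (dist p.1 p.2 ^ 2)) ∂J < ∞) :
    (closureForm Λ J 𝓒).IsDirichlet where
  dense_domain := hC.dense_domain hJ1
  symm u v := by rw [closureForm_form, closureForm_form, real_inner_comm]
  nonneg u := by rw [closureForm_form]; exact real_inner_self_nonneg
  coercive := ⟨1, one_pos, closureForm_coercive⟩
  complete := closureForm_complete hJ
  markov := closureForm_markov hJ (hC.finiteEnergy hJ1) hC.comp
  one_mem := by
    have h1 := graphPoint_mem (hC.comp.const_mem 1)
      (hC.finiteEnergy (Λ := Λ) hJ1 _ (hC.comp.const_mem 1))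
    exact mem_closureForm_domain.2 ⟨_, h1⟩

end Metric

/-! ### Capacity estimates and quasi-uniform convergence -/

section QuasiRegular

variable {E : Type*} [MeasurableSpace E] {Λ : Measure E}

theorem L2Form.capOpen_le [TopologicalSpace E] (𝓔 : L2Form Λ) {O : Set E} (u : 𝓔.domain)
    (hu : ∀ᵐ x ∂Λ, x ∈ O → 1 ≤ (u : Lp ℝ 2 Λ) x) : 𝓔.capOpen O ≤ ENNReal.ofReal (𝓔.form1 u u) :=
  iInf₂_le u hu

theorem L2Form.cap_le [TopologicalSpace E] (𝓔 : L2Form Λ) {O : Set E} (hO : IsOpen O)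
    (u : 𝓔.domain) (hu : ∀ᵐ x ∂Λ, x ∈ O → 1 ≤ (u : Lp ℝ 2 Λ) x) :
    𝓔.cap O ≤ ENNReal.ofReal (𝓔.form1 u u) :=
  (iInf_le_of_le O (iInf₂_le hO subset_rfl)).trans (𝓔.capOpen_le u hu)

theorem L2Form.cap_empty [TopologicalSpace E] (𝓔 : L2Form Λ) : 𝓔.cap ∅ = 0 := by
  refine le_antisymm ((𝓔.cap_le isOpen_empty 0 (by simp)).trans_eq ?_) zero_le
  rw [L2Form.form1, map_zero, zero_add, ENNReal.ofReal_eq_zero]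
  refine (integral_eq_zero_of_ae ?_).le
  filter_upwards [Lp.coeFn_zero ℝ 2 Λ] with x hx
  exact mul_eq_zero_of_left hx _

theorem L2Form.quasiContinuous_of_continuous [TopologicalSpace E] [OpensMeasurableSpace E]
    (𝓔 : L2Form Λ) {f : E → ℝ} (hf : Continuous f) : 𝓔.QuasiContinuous f :=
  ⟨hf.measurable, fun _ => univ, ⟨fun _ => isClosed_univ, by simp [𝓔.cap_empty]⟩,
    fun _ => hf.continuousOn⟩

variable {J : Measure (E × E)} {𝓒 : Submodule ℝ (E → ℝ)}

theorem closureForm_core_dense [SFinite Λ] (hJ : J ≪ Λ.prod Λ) (h : FiniteEnergy Λ J 𝓒)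
    (u : (closureForm Λ J 𝓒).domain) {ε : ℝ} (hε : 0 < ε) :
    ∃ v : (closureForm Λ J 𝓒).domain, (∃ f ∈ 𝓒, f =ᵐ[Λ] (v : Lp ℝ 2 Λ)) ∧
      (closureForm Λ J 𝓒).form1 (u - v) (u - v) < ε := by
  obtain ⟨f, hf, hlim⟩ := exists_seq_of_mem_closedGraph h (jumpGrad_mem hJ u)
  have hv (n) : ((h _ (hf n)).1.toLp (f n), (h _ (hf n)).2.toLp (jumpDiff (f n))) ∈
      closedGraph Λ J 𝓒 := graphPoint_mem (hf n) (h _ (hf n))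
  let v (n : ℕ) : (closureForm Λ J 𝓒).domain := ⟨_, mem_closureForm_domain.2 ⟨_, hv n⟩⟩
  have h1 : Tendsto (fun n => (closureForm Λ J 𝓒).form1 (u - v n) (u - v n)) atTop (𝓝 0) := by
    simp only [closureForm_form1_self, map_sub, Submodule.coe_sub,
      fun n => jumpGrad_eq hJ (v n) (hv n)]
    have h2 := ((continuous_snd.tendsto _).comp hlim).const_sub (jumpGrad Λ J 𝓒 u)
    have h3 := ((continuous_fst.tendsto _).comp hlim).const_sub (u : Lp ℝ 2 Λ)
    simpa [graphPoint, v] using (h2.norm.pow 2).add (h3.norm.pow 2)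
  obtain ⟨n, hn⟩ := (h1.eventually_lt_const hε).exists
  exact ⟨v n, ⟨f n, hf n, (h _ (hf n)).1.coeFn_toLp.symm⟩, hn⟩

/-- A sequence of nonnegative functions that converges to `0` in the domain has a subsequence that
converges to `0` uniformly off open sets of arbitrarily small capacity. -/
theorem exists_quasiUniform_subseq [TopologicalSpace E] [IsFiniteMeasure Λ] (hJ : J ≪ Λ.prod Λ)
    {u : ℕ → E → ℝ} (hu : ∀ n, MemDomain Λ J 𝓒 (u n)) (hcont : ∀ n, Continuous (u n))
    (hpos : ∀ n x, 0 ≤ u n x) (h1 : Tendsto (fun n => eLpNorm (u n) 2 Λ) atTop (𝓝 0))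
    (h2 : Tendsto (fun n => eLpNorm (jumpDiff (u n)) 2 J) atTop (𝓝 0)) :
    ∃ ns : ℕ → ℕ, (closureForm Λ J 𝓒).IsNest
      fun m => ⋂ k : ℕ, {x | u (ns (k + m)) x ≤ 1 / ((k + m : ℕ) + 1 : ℝ)} := by
  choose q hq hq1 hq2 using fun n => (hu n).exists_graph hJ
  have hq0 : Tendsto q atTop (𝓝 0) := by
    have t1 := tendsto_toLp_of_eLpNorm (f := 0) MemLp.zero hq1 (by simpa using h1)
    have t2 := tendsto_toLp_of_eLpNorm (f := 0) MemLp.zero hq2 (by simpa using h2)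
    exact t1.prodMk_nhds t2
  -- The weight `k + 1` turns `u > 1/(k+1)` into a value above `1`, as the definition of capacity
  -- requires; `2⁻ᵏ` makes the weighted series summable.
  have hex (k : ℕ) : ∃ n, ‖((k : ℝ) + 1) • q n‖ < (1 / 2 : ℝ) ^ k := by
    have h3 := (hq0.const_smul ((k : ℝ) + 1)).norm
    rw [smul_zero, norm_zero] at h3
    exact (h3.eventually_lt_const (by positivity)).exists
  choose ns hns using hex
  let p (k : ℕ) : Lp ℝ 2 Λ × Lp ℝ 2 J := ((k : ℝ) + 1) • q (ns k)
  have hp (k) : p k ∈ closedGraph Λ J 𝓒 := Submodule.smul_mem _ _ (hq _)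
  have hp1 (k) : (p k).1 =ᵐ[Λ] fun x => ((k : ℝ) + 1) * u (ns k) x := by
    refine (Lp.coeFn_smul _ _).trans ?_
    filter_upwards [hq1 (ns k)] with x hx
    rw [Pi.smul_apply, hx, smul_eq_mul]
  have hsum : Summable p := .of_norm_bounded summable_geometric_two fun k => (hns k).le
  -- All terms are nonnegative, so this tail dominates each of them. It is at least `1` a.e. off the
  -- `m`-th set, and its `𝓔₁`-norm tends to `0`.
  let w (m : ℕ) : Lp ℝ 2 Λ × Lp ℝ 2 J := ∑' k, p (k + m)
  have hw (m) : HasSum (fun k => p (k + m)) (w m) :=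
    ((summable_nat_add_iff m).2 hsum).hasSum
  have hw0 : Tendsto w atTop (𝓝 0) := tendsto_sum_nat_add p
  have hwmem (m) : w m ∈ closedGraph Λ J 𝓒 :=
    isClosed_closedGraph.mem_of_tendsto (hw m)
      (Eventually.of_forall fun s => Submodule.sum_mem _ fun k _ => hp _)
  have hge (m : ℕ) : ∀ᵐ x ∂Λ, ∀ k : ℕ,
      (((k + m : ℕ) : ℝ) + 1) * u (ns (k + m)) x ≤ (w m).1 x := by
    refine ae_all_iff.2 fun k => ?_
    have h3 : HasSum (fun k => (p (k + m)).1) (w m).1 :=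
      (hw m).map (AddMonoidHom.fst _ _) continuous_fst
    have h4 : (p (k + m)).1 ≤ (w m).1 := by
      refine le_hasSum h3 k fun j _ => ?_
      rw [← Lp.coeFn_nonneg]
      filter_upwards [hp1 (j + m)] with x hx
      rw [hx]
      exact mul_nonneg (by positivity) (hpos _ _)
    rw [← Lp.coeFn_le] at h4
    filter_upwards [h4, hp1 (k + m)] with x h5 h6
    rwa [h6] at h5
  have hclosed (m : ℕ) :
      IsClosed (⋂ k : ℕ, {x | u (ns (k + m)) x ≤ 1 / ((k + m : ℕ) + 1 : ℝ)}) :=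
    isClosed_iInter fun k => isClosed_le (hcont _) continuous_const
  refine ⟨ns, hclosed, ?_⟩
  let W (m : ℕ) : (closureForm Λ J 𝓒).domain :=
    ⟨(w m).1, mem_closureForm_domain.2 ⟨(w m).2, hwmem m⟩⟩
  have hlim : Tendsto (fun m => ENNReal.ofReal ((closureForm Λ J 𝓒).form1 (W m) (W m)))
      atTop (𝓝 0) := by
    simp only [closureForm_form1_self, fun m => jumpGrad_eq hJ (W m) (hwmem m)]
    have h3 := ((continuous_snd.tendsto _).comp hw0).norm.pow 2
    have h4 := ((continuous_fst.tendsto _).comp hw0).norm.pow 2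
    have h5 := ENNReal.tendsto_ofReal (h3.add h4)
    rw [Prod.fst_zero, Prod.snd_zero, norm_zero, norm_zero, zero_pow two_ne_zero, add_zero,
      ENNReal.ofReal_zero] at h5
    exact h5
  refine tendsto_of_tendsto_of_tendsto_of_le_of_le tendsto_const_nhds hlim (fun _ => zero_le)
    fun m => L2Form.cap_le _ (hclosed m).isOpen_compl (W m) ?_
  filter_upwards [hge m] with x hx hxm
  simp only [mem_compl_iff, mem_iInter, not_forall, mem_ofPred_eq, not_le] at hxm
  obtain ⟨k, hk⟩ := hxm
  refine le_trans ?_ (hx k)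
  have h5 : (0 : ℝ) < ((k + m : ℕ) : ℝ) + 1 := by positivity
  rw [div_lt_iff₀ h5] at hk
  linarith

end QuasiRegular

/-! ### Compact nests and quasi-regularity -/

section Metric

variable {E : Type*} [MetricSpace E] [MeasurableSpace E] [BorelSpace E]
  [SecondCountableTopology E] [CompleteSpace E] {Λ : Measure E} {J : Measure (E × E)}
  {𝓒 : Submodule ℝ (E → ℝ)}

/-- With `a` a dense sequence, the minimum over `k ≤ n` of `arctan (dist · (a k))` tends to `0` at
every point. Where a subsequence does so uniformly, finitely many `a k` form an `ε`-net for each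
`ε`. -/
theorem LipschitzCore.exists_compact_nest [IsFiniteMeasure Λ] [Nonempty E]
    (hC : LipschitzCore 𝓒) (hJ : J ≪ Λ.prod Λ)
    (hJ1 : ∫⁻ p, ENNReal.ofReal (min 1 (dist p.1 p.2 ^ 2)) ∂J < ∞) :
    ∃ K : ℕ → Set E, (closureForm Λ J 𝓒).IsNest K ∧ ∀ n, IsCompact (K n) := by
  have hE : FiniteEnergy Λ J 𝓒 := hC.finiteEnergy hJ1
  let a := TopologicalSpace.denseSeq E
  let u : ℕ → E → ℝ := fun n => -partialSups (fun k => -arctanDist (a k)) n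
  have hu (n) : MemDomain Λ J 𝓒 (u n) :=
    (partialSups_induction (fun f g hf hg => hf.sup hJ hE hC.comp hg)
      (fun k => (hC.memDomain_arctanDist hJ hJ1 (a k)).neg) n).neg
  have hul (n) : BddLip (u n) :=
    (partialSups_induction (fun f g hf hg => hf.sup hg)
      (fun k => (arctanDist_bddLip (a k)).neg) n).neg
  have hpos (n) (x : E) : 0 ≤ u n x := by
    have := (partialSups_le (fun k => -arctanDist (a k)) n 0 fun k _ y => by
      simpa using arctanDist_nonneg (a k) y) x
    simpa [u] using this
  have hle (n k : ℕ) (hk : k ≤ n) (x : E) : u n x ≤ arctanDist (a k) x := by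
    have := le_partialSups_of_le (fun k => -arctanDist (a k)) hk x
    simp only [Pi.neg_apply] at this
    simp only [u, Pi.neg_apply]
    linarith
  have hlt (n : ℕ) (x : E) (s : ℝ) (h : u n x < Real.arctan s) :
      ∃ k ≤ n, dist x (a k) < s := by
    classical
    by_contra! hcon
    -- The bound is needed only at `x`, but the supremum is taken among functions; the comparison
    -- function is `-arctan s` at `x` and the trivial bound `0` elsewhere.
    have := (partialSups_le (fun k => -arctanDist (a k)) n
      (fun y => if y = x then -Real.arctan s else 0) fun k hk y => ?_) x
    · simp only [if_true] at this
      simp only [u, Pi.neg_apply] at h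
      linarith
    · simp only [Pi.neg_apply]
      split_ifs with hy
      · subst hy
        exact neg_le_neg (Real.arctan_strictMono.monotone (hcon k hk))
      · simpa using arctanDist_nonneg (a k) y
  have hlim (x : E) : Tendsto (fun n => u n x) atTop (𝓝 0) := by
    rw [Metric.tendsto_atTop]
    intro ε hε
    obtain ⟨k, hk⟩ := (TopologicalSpace.denseRange_denseSeq E).exists_dist_lt x hε
    refine ⟨k, fun n hn => ?_⟩
    rw [Real.dist_eq, sub_zero, abs_of_nonneg (hpos n x)]
    refine (hle n k hn x).trans_lt (lt_of_le_of_lt ?_ hk)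
    have h1 := abs_arctan_sub_arctan_le (dist x (a k)) 0
    rw [Real.arctan_zero, sub_zero, sub_zero, abs_of_nonneg dist_nonneg] at h1
    exact (le_abs_self _).trans h1
  obtain ⟨l1, l2⟩ := BddLip.tendsto_eLpNorm (Λ := Λ) (f := fun _ => 0) hJ1 hul hlim
  obtain ⟨ns, hns⟩ := exists_quasiUniform_subseq hJ hu (fun n => (hul n).continuous) hpos
    (l1.congr fun n => by congr 1; ext x; simp)
    (l2.congr fun n => by congr 1; ext x; simp [jumpDiff])
  refine ⟨_, hns, fun m => isCompact_iff_totallyBounded_isComplete.2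
    ⟨Metric.totallyBounded_iff.2 fun ε hε => ?_, (hns.1 m).isComplete⟩⟩
  obtain ⟨k, hk⟩ := exists_nat_one_div_lt (Real.arctan_pos.2 hε)
  refine ⟨a '' Iic (ns (k + m)), (finite_Iic _).image a, fun x hx => ?_⟩
  have h1 : u (ns (k + m)) x ≤ 1 / ((k + m : ℕ) + 1 : ℝ) := mem_iInter.1 hx k
  have h2 : 1 / ((k + m : ℕ) + 1 : ℝ) ≤ 1 / ((k : ℝ) + 1) :=
    Nat.one_div_le_one_div (Nat.le_add_right k m)
  obtain ⟨j, hj, hd⟩ := hlt _ x ε (h1.trans_lt (h2.trans_lt hk))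
  exact mem_biUnion (mem_image_of_mem a hj) hd

theorem LipschitzCore.isQuasiRegular [IsProbabilityMeasure Λ] (hC : LipschitzCore 𝓒)
    (hJ : J ≪ Λ.prod Λ)
    (hJ1 : ∫⁻ p, ENNReal.ofReal (min 1 (dist p.1 p.2 ^ 2)) ∂J < ∞) :
    (closureForm Λ J 𝓒).IsQuasiRegular := by
  have : Nonempty E := nonempty_of_isProbabilityMeasure Λ
  have hE : FiniteEnergy Λ J 𝓒 := hC.finiteEnergy hJ1
  -- The exceptional set is empty: distances to a dense sequence separate all points.
  refine ⟨hC.exists_compact_nest hJ hJ1, ?_, ∅, L2Form.cap_empty _,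
    fun n => arctanDist (TopologicalSpace.denseSeq E n), fun n => ⟨?_, ?_⟩, ?_⟩
  · refine ⟨⟨⟨⟨{v | ∃ f ∈ 𝓒, f =ᵐ[Λ] (v : Lp ℝ 2 Λ)}, ?_⟩, ?_⟩, ?_⟩, ?_, fun u ε hε => ?_⟩
    · rintro v w ⟨f, hf, h1⟩ ⟨g, hg, h2⟩
      exact ⟨f + g, add_mem hf hg, (h1.add h2).trans (Lp.coeFn_add _ _).symm⟩
    · exact ⟨0, zero_mem _, (Lp.coeFn_zero ℝ 2 Λ).symm⟩
    · rintro c v ⟨f, hf, h1⟩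
      exact ⟨c • f, 𝓒.smul_mem c hf, (h1.const_smul c).trans (Lp.coeFn_smul _ _).symm⟩
    · rintro v ⟨f, hf, h1⟩
      exact ⟨f, L2Form.quasiContinuous_of_continuous _ (hC.continuous hf), h1⟩
    · obtain ⟨v, hv, h1⟩ := closureForm_core_dense hJ hE u hε
      exact ⟨v, hv, h1⟩
  · exact L2Form.quasiContinuous_of_continuous _ (arctanDist_bddLip _).continuous
  · obtain ⟨w, hw⟩ := (hC.memDomain_arctanDist hJ hJ1
      (TopologicalSpace.denseSeq E n)).exists_lift
    exact ⟨w, hw.symm⟩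
  · intro x _ y _ hxy
    by_contra! hcon
    obtain ⟨k, hk⟩ := (TopologicalSpace.denseRange_denseSeq E).exists_dist_lt x
      (show 0 < dist x y / 2 by have := dist_pos.2 hxy; positivity)
    have h1 := Real.arctan_injective (hcon k)
    have h2 := dist_triangle_right x y (TopologicalSpace.denseSeq E k)
    linarith

theorem LipschitzCore.jumpForm_closure [IsProbabilityMeasure Λ] (hC : LipschitzCore 𝓒)
    (hJ1 : ∫⁻ p, ENNReal.ofReal (min 1 (dist p.1 p.2 ^ 2)) ∂J < ∞) (hJ : J ≪ Λ.prod Λ) :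
    (∀ u ∈ 𝓒, MemLp u 2 Λ) ∧
      (∀ u ∈ 𝓒, ∀ v ∈ 𝓒, Integrable (fun p => (u p.1 - u p.2) * (v p.1 - v p.2)) J) ∧
      IsClosable Λ 𝓒 (jumpForm J) ∧
      ∃ 𝓔 : L2Form Λ, IsClosure Λ 𝓒 (jumpForm J) 𝓔 ∧ 𝓔.IsDirichlet ∧ 𝓔.IsQuasiRegular :=
  have hE : FiniteEnergy Λ J 𝓒 := hC.finiteEnergy hJ1
  ⟨fun u hu => (hE u hu).1, fun u hu v hv => (hE u hu).2.integrable_mul (hE v hv).2,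
    isClosable_jumpForm hJ hE, closureForm Λ J 𝓒, isClosure_closureForm hJ hE,
    hC.isDirichlet hJ hJ1, hC.isQuasiRegular hJ hJ1⟩

end Metric

/-! ### From bounded derivatives along Dirac masses to estimates in the added mass -/

section DiracSteps

variable {M : Type*} [MeasurableSpace M]

theorem mass_add (μ ν : FiniteMeasure M) : (μ + ν).mass = μ.mass + ν.mass := by
  simp only [FiniteMeasure.mass, FiniteMeasure.coeFn_add, Pi.add_apply]

/-- The Dirac measure, as a finite measure. -/
abbrev diracFin (x : M) : FiniteMeasure M := (diracProba x).toFiniteMeasure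

theorem toMeasure_diracFin (x : M) : (diracFin x : Measure M) = Measure.dirac x := rfl

theorem mass_smul_dirac (c : ℝ≥0) (x : M) : (c • diracFin x).mass = c := by
  simp only [FiniteMeasure.mass, FiniteMeasure.coeFn_smul, Pi.smul_apply]
  simp

/-- After normalization, adding an atom becomes a convex step towards it. This converts convexity
derivatives into extrinsic ones. -/
theorem normalize_add_smul_dirac [Nonempty M] {κ : FiniteMeasure M} (hκ : κ ≠ 0) (ε : ℝ≥0) (x : M)
    (t : unitInterval) (ht : (t : ℝ) = ε / (κ.mass + ε)) :
    (κ + ε • diracFin x).normalize = mixDirac t κ.normalize x := by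
  have hm : 0 < κ.mass := pos_iff_ne_zero.2 (κ.mass_nonzero_iff.2 hκ)
  have hmass : (κ + ε • diracFin x).mass = κ.mass + ε := by
    rw [mass_add, mass_smul_dirac]
  have hne : κ + ε • diracFin x ≠ 0 := by
    rw [← FiniteMeasure.mass_nonzero_iff, hmass]
    exact (add_pos_of_pos_of_nonneg hm ε.2).ne'
  have e1 : ENNReal.ofReal (1 - t) * (κ.mass⁻¹ : ℝ≥0) = ((κ.mass + ε)⁻¹ : ℝ≥0) := by
    rw [← ENNReal.ofReal_coe_nnreal, ← ENNReal.ofReal_coe_nnreal,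
      ← ENNReal.ofReal_mul (sub_nonneg.2 t.2.2)]
    congr 1
    rw [ht]
    have h1 : (0 : ℝ) < κ.mass := hm
    have h2 : (0 : ℝ) ≤ ε := ε.2
    push_cast
    field_simp
    ring
  have e2 : ENNReal.ofReal (t : ℝ) = (((κ.mass + ε)⁻¹ : ℝ≥0) : ℝ≥0∞) * (ε : ℝ≥0∞) := by
    rw [← ENNReal.coe_mul, ← ENNReal.ofReal_coe_nnreal]
    congr 1
    rw [ht]
    push_cast
    field_simp
  apply ProbabilityMeasure.toMeasure_injective
  rw [FiniteMeasure.toMeasure_normalize_eq_of_nonzero _ hne, hmass]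
  change _ = ENNReal.ofReal (1 - (t : ℝ)) • (κ.normalize : Measure M) +
    ENNReal.ofReal (t : ℝ) • Measure.dirac x
  rw [FiniteMeasure.toMeasure_normalize_eq_of_nonzero _ hκ, FiniteMeasure.toMeasure_add,
    FiniteMeasure.toMeasure_smul, toMeasure_diracFin]
  ext s -
  simp only [Measure.smul_apply, Measure.add_apply, ENNReal.smul_def,
    smul_eq_mul, mul_add, ← mul_assoc, e1, e2]

variable [TopologicalSpace M] [BorelSpace M]

/-- Mean value inequality for `s ↦ V(ν + s δ_x)`: its right derivative at `s` is the extrinsic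
derivative at `ν + s δ_x`, and a bounded right derivative suffices for a continuous function. -/
theorem abs_add_smul_dirac_sub_le {V : FiniteMeasure M → ℝ} (hV : Continuous V) {C : ℝ}
    (hD : ∀ ν x, ∃ d, |d| ≤ C ∧
      Tendsto (fun ε : ℝ≥0 => (V (ν + ε • diracFin x) - V ν) / (ε : ℝ)) (𝓝[>] 0) (𝓝 d))
    (ν : FiniteMeasure M) (x : M) (c : ℝ≥0) : |V (ν + c • diracFin x) - V ν| ≤ C * c := by
  let f : ℝ → ℝ := fun s => V (ν + s.toNNReal • diracFin x)
  have hf : Continuous f := by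
    refine hV.comp (continuous_const.add ?_)
    exact (continuous_real_toNNReal).smul continuous_const
  choose d hd hdl using fun s : ℝ => hD (ν + s.toNNReal • diracFin x) x
  have hder : ∀ s ∈ Ico (0 : ℝ) c, HasDerivWithinAt f (d s) (Ici s) s := by
    intro s hs
    rw [← hasDerivWithinAt_Ioi_iff_Ici, hasDerivWithinAt_iff_tendsto_slope' self_notMem_Ioi]
    have hmap : Tendsto (fun t : ℝ => (t - s).toNNReal) (𝓝[>] s) (𝓝[>] 0) := by
      refine tendsto_nhdsWithin_iff.2 ⟨?_, ?_⟩
      · have : Continuous fun t : ℝ => (t - s).toNNReal := by fun_prop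
        simpa using (this.tendsto s).mono_left nhdsWithin_le_nhds
      · filter_upwards [self_mem_nhdsWithin] with t ht
        exact Real.toNNReal_pos.2 (sub_pos.2 ht)
    refine ((hdl s).comp hmap).congr' ?_
    filter_upwards [self_mem_nhdsWithin] with t ht
    have ht' : s < t := ht
    have h1 : ν + s.toNNReal • diracFin x + (t - s).toNNReal • diracFin x =
        ν + t.toNNReal • diracFin x := by
      rw [add_assoc, ← add_smul, ← Real.toNNReal_add hs.1 (by linarith), add_sub_cancel]
    simp only [Function.comp_apply, h1, Real.coe_toNNReal _ (sub_nonneg.2 ht'.le)]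
    rw [slope_def_field]
  have := norm_image_sub_le_of_norm_deriv_right_le_segment hf.continuousOn hder
    (fun s _ => hd s) c ⟨c.2, le_rfl⟩
  simpa [f] using this

/-- Atoms are added one at a time; `C` does not depend on the measure already built. -/
theorem abs_add_sum_dirac_sub_le {V : FiniteMeasure M → ℝ} (hV : Continuous V) {C : ℝ}
    (hD : ∀ ν x, ∃ d, |d| ≤ C ∧
      Tendsto (fun ε : ℝ≥0 => (V (ν + ε • diracFin x) - V ν) / (ε : ℝ)) (𝓝[>] 0) (𝓝 d))
    (s : Finset M) (c : M → ℝ≥0) :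
    |V (∑ a ∈ s, c a • diracFin a) - V 0| ≤ C * (∑ a ∈ s, c a : ℝ≥0) := by
  classical
  induction s using Finset.induction_on with
  | empty => simp
  | insert a s ha ih =>
    rw [Finset.sum_insert ha, Finset.sum_insert ha, add_comm, NNReal.coe_add, mul_add]
    have h1 := abs_add_smul_dirac_sub_le hV hD (∑ a ∈ s, c a • diracFin a) a (c a)
    exact (abs_sub_le _ _ _).trans (add_le_add h1 ih)

variable [PolishSpace M]

/-- If the extrinsic derivative of `V` is bounded by `C`, then `|V ν - V 0| ≤ C ν(M)`. -/
theorem abs_sub_zero_le_mass {V : FiniteMeasure M → ℝ} (hV : Continuous V) {C : ℝ}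
    (hD : ∀ ν x, ∃ d, |d| ≤ C ∧
      Tendsto (fun ε : ℝ≥0 => (V (ν + ε • diracFin x) - V ν) / (ε : ℝ)) (𝓝[>] 0) (𝓝 d))
    (ν : FiniteMeasure M) : |V ν - V 0| ≤ C * ν.mass := by
  rcases isEmpty_or_nonempty M with hM | ⟨⟨x₀⟩⟩
  · have : ν = 0 := by
      apply FiniteMeasure.toMeasure_injective
      exact Measure.eq_zero_of_isEmpty _
    simp [this]
  let _ := TopologicalSpace.upgradeIsCompletelyMetrizable M
  -- Simple functions converging to the identity push `ν` to finitely supported measures of the same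
  -- mass that converge weakly to `ν`.
  let T : ℕ → SimpleFunc M M := SimpleFunc.approxOn id measurable_id univ x₀ (mem_univ _)
  have hT (x : M) : Tendsto (fun n => T n x) atTop (𝓝 x) :=
    SimpleFunc.tendsto_approxOn measurable_id (mem_univ _) (by simp)
  have hmap (n) : ν.map (T n) = ∑ a ∈ (T n).range, ν (T n ⁻¹' {a}) • diracFin a := by
    apply FiniteMeasure.toMeasure_injective
    rw [FiniteMeasure.toMeasure_map, (Measure.ae_mem_finset_iff_map_eq_sum_dirac
      (s := (T n).range) (T n).measurable.aemeasurable).1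
      (Eventually.of_forall fun x => (T n).mem_range_self x), FiniteMeasure.toMeasure_sum]
    refine Finset.sum_congr rfl fun a _ => ?_
    rw [FiniteMeasure.toMeasure_smul, toMeasure_diracFin,
      ← FiniteMeasure.ennreal_coeFn_eq_coeFn_toMeasure]
    rfl
  have hmass (n) : ∑ a ∈ (T n).range, ν (T n ⁻¹' {a}) = ν.mass := by
    have h1 : (ν.map (T n)).mass = ν.mass := by
      rw [FiniteMeasure.mass, FiniteMeasure.map_apply _ (T n).measurable MeasurableSet.univ]
      rfl
    have h2 : ∀ (s : Finset M) (c : M → ℝ≥0),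
        (∑ a ∈ s, c a • diracFin a).mass = ∑ a ∈ s, c a := by
      intro s c
      classical
      induction s using Finset.induction_on with
      | empty => simp
      | insert a s ha ih =>
        rw [Finset.sum_insert ha, Finset.sum_insert ha, ← ih]
        rw [mass_add, mass_smul_dirac]
    rw [← h1, hmap, h2]
  have hconv : Tendsto (fun n => ν.map (T n)) atTop (𝓝 ν) := by
    rw [FiniteMeasure.tendsto_iff_forall_integral_tendsto]
    intro f
    have h1 (n) : ∫ x, f x ∂(ν.map (T n) : Measure M) = ∫ x, f (T n x) ∂(ν : Measure M) := by
      rw [FiniteMeasure.toMeasure_map, integral_map (T n).measurable.aemeasurable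
        f.continuous.aestronglyMeasurable]
    simp only [h1]
    refine tendsto_integral_of_dominated_convergence (fun _ => ‖f‖)
      (fun n => (f.continuous.measurable.comp (T n).measurable).aestronglyMeasurable)
      (integrable_const _) (fun n => Eventually.of_forall fun x => f.norm_coe_le_norm _)
      (Eventually.of_forall fun x => (f.continuous.tendsto x).comp (hT x))
  refine le_of_tendsto' (((hV.tendsto ν).comp hconv).sub_const (V 0)).abs fun n => ?_
  have := abs_add_sum_dirac_sub_le hV hD (T n).range (fun a => ν (T n ⁻¹' {a}))
  rwa [hmass, ← hmap] at this

/-- Functions with bounded extrinsic derivative are Lipschitz in the mass that is added. -/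
theorem abs_add_sub_le_of_isExtrinsicDeriv {u : FiniteMeasure M → ℝ} (hu : Continuous u)
    {D : FiniteMeasure M → M → ℝ} (hD : IsExtrinsicDeriv u D) {C : ℝ} (hC : ∀ μ x, |D μ x| ≤ C)
    (κ ν : FiniteMeasure M) : |u (κ + ν) - u κ| ≤ C * ν.mass := by
  have := abs_sub_zero_le_mass (V := fun ν => u (κ + ν)) (C := C)
    (hu.comp (continuous_const.add continuous_id))
    (fun ν x => ⟨D (κ + ν) x, hC _ _, by simpa only [add_assoc] using hD (κ + ν) x⟩) ν
  simpa using this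

/-- Functions with bounded convexity extrinsic derivative, composed with the normalization of
measures, are Lipschitz in the mass that is added to a fixed nonzero measure. -/
theorem abs_normalize_add_sub_le [Nonempty M] {u : ProbabilityMeasure M → ℝ} (hu : Continuous u)
    {D : ProbabilityMeasure M → M → ℝ} (hD : IsConvexExtrinsicDeriv u D) {C : ℝ}
    (hC : ∀ μ x, |D μ x| ≤ C) {κ : FiniteMeasure M} (hκ : κ ≠ 0) (ν : FiniteMeasure M) :
    |u (κ + ν).normalize - u κ.normalize| ≤ C / κ.mass * ν.mass := by
  have hκm : (0 : ℝ) < κ.mass := NNReal.coe_pos.2 <| pos_iff_ne_zero.2 (κ.mass_nonzero_iff.2 hκ)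
  have hne (ν : FiniteMeasure M) : κ + ν ≠ 0 := by
    rw [← FiniteMeasure.mass_nonzero_iff, mass_add]
    exact (add_pos_of_pos_of_nonneg (NNReal.coe_pos.1 hκm) ν.mass.2).ne'
  have := abs_sub_zero_le_mass (V := fun ν => u (κ + ν).normalize) (C := C / κ.mass) ?_ ?_ ν
  · simpa using this
  · refine hu.comp (continuous_iff_continuousAt.2 fun ν => ?_)
    exact FiniteMeasure.tendsto_normalize_of_tendsto
      ((continuous_const.add continuous_id).tendsto ν) (hne ν)
  · intro ν x
    set m : ℝ≥0 := (κ + ν).mass with hm_def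
    have hmκ : (κ.mass : ℝ) ≤ m := by
      rw [hm_def, mass_add]; exact_mod_cast le_add_of_nonneg_right ν.mass.2
    have hm : (0 : ℝ) < m := hκm.trans_le hmκ
    refine ⟨D (κ + ν).normalize x / m, ?_, ?_⟩
    -- The derivative acquires the factor `1/m`, and `m` is at least the mass of `κ`.
    · rw [abs_div, abs_of_pos hm]
      have h1 := hC (κ + ν).normalize x
      exact div_le_div₀ ((abs_nonneg _).trans h1) h1 hκm hmκ
    · have ht (ε : ℝ≥0) : (ε : ℝ) / (m + ε) ∈ unitInterval :=
        ⟨by positivity, div_le_one_of_le₀ (by linarith) (by positivity)⟩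
      -- Time change between the two derivatives: `t ε / ε = 1/(m + ε) → 1/m`.
      let t : ℝ≥0 → unitInterval := fun ε => ⟨(ε : ℝ) / (m + ε), ht ε⟩
      have htt : Tendsto t (𝓝[>] 0) (𝓝[>] 0) := by
        refine tendsto_nhdsWithin_iff.2 ⟨?_, ?_⟩
        · have hc : ContinuousAt t 0 := by
            refine Topology.IsInducing.subtypeVal.continuousAt_iff.2 ?_
            exact ContinuousAt.div (by fun_prop) (by fun_prop) (by simpa using hm.ne')
          have h0 : t 0 = 0 := Subtype.ext (by simp [t])
          have := hc.tendsto
          rw [h0] at this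
          exact this.mono_left nhdsWithin_le_nhds
        · filter_upwards [self_mem_nhdsWithin] with ε hε
          have hε' : (0 : ℝ) < ε := hε
          change (0 : ℝ) < (ε : ℝ) / (m + ε)
          positivity
      have h1 := (hD (κ + ν).normalize x).comp htt
      have h2 : Tendsto (fun ε : ℝ≥0 => ((m : ℝ) + ε)⁻¹) (𝓝[>] 0) (𝓝 (m : ℝ)⁻¹) := by
        have hc : ContinuousAt (fun ε : ℝ≥0 => ((m : ℝ) + ε)⁻¹) 0 :=
          ContinuousAt.inv₀ (by fun_prop) (by simpa using hm.ne')
        simpa using hc.tendsto.mono_left nhdsWithin_le_nhds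
      rw [div_eq_mul_inv]
      refine (h1.mul h2).congr' ?_
      filter_upwards [self_mem_nhdsWithin] with ε hε
      have hε' : (0 : ℝ) < ε := hε
      rw [Function.comp_apply, ← add_assoc, normalize_add_smul_dirac (hne ν) ε x (t ε) rfl]
      simp only [t]
      field_simp

end DiracSteps

/-! ### Total variation geometry of absolutely continuous measures -/

section ACSpace

variable {M : Type*} [MeasurableSpace M] {lam : Measure M}

namespace ACFinite

theorem density_nonneg (μ : ACFinite lam) (x : M) : 0 ≤ μ.density x := ENNReal.toReal_nonneg

theorem integrable_density_mul (μ : ACFinite lam) {f : M → ℝ} (hf : Measurable f) {C : ℝ}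
    (hC : ∀ x, |f x| ≤ C) : Integrable (fun x => μ.density x * f x) lam :=
  μ.integrable_density.mul_bdd (c := C) hf.aestronglyMeasurable (Eventually.of_forall hC)

theorem measurable_density (μ : ACFinite lam) : Measurable μ.density :=
  (Measure.measurable_rnDeriv _ _).ennreal_toReal

theorem integrable_abs_sub (μ ν : ACFinite lam) :
    Integrable (fun x => |μ.density x - ν.density x|) lam :=
  (μ.integrable_density.sub ν.integrable_density).abs

variable [SigmaFinite lam]

theorem dist_def (μ ν : ACFinite lam) : dist μ ν = ∫ x, |μ.density x - ν.density x| ∂lam := rfl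

/-- The density, as an element of `L¹`. -/
def toL1 (μ : ACFinite lam) : Lp ℝ 1 lam := (memLp_one_iff_integrable.2 μ.integrable_density).toLp _

theorem isometry_toL1 : Isometry (toL1 : ACFinite lam → Lp ℝ 1 lam) := by
  refine Isometry.of_dist_eq fun μ ν => ?_
  rw [dist_eq_norm, toL1, toL1, ← MemLp.toLp_sub, Lp.norm_toLp, eLpNorm_one_eq_lintegral_enorm,
    dist_def, integral_eq_lintegral_of_nonneg_ae (Eventually.of_forall fun _ => abs_nonneg _)
      (μ.integrable_abs_sub ν).1]
  congr 1
  refine lintegral_congr fun x => ?_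
  rw [Real.enorm_eq_ofReal_abs]
  rfl

/-- Identifies the space isometrically with the closed positive cone of `L¹`, from which
completeness follows. -/
theorem range_toL1 : range (toL1 : ACFinite lam → Lp ℝ 1 lam) = Ici 0 := by
  ext f
  rw [mem_Ici, ← Lp.coeFn_nonneg]
  constructor
  · rintro ⟨μ, rfl⟩
    filter_upwards [(memLp_one_iff_integrable.2 μ.integrable_density).coeFn_toLp] with x hx
    rw [toL1, hx]
    exact μ.density_nonneg x
  · intro hf
    have hfi : Integrable f lam := L1.integrable_coeFn f
    have hm : AEMeasurable (fun x => ENNReal.ofReal (f x)) lam := hfi.1.aemeasurable.ennreal_ofReal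
    refine ⟨⟨lam.withDensity fun x => ENNReal.ofReal (f x),
      isFiniteMeasure_withDensity hfi.lintegral_lt_top.ne, withDensity_absolutelyContinuous _ _⟩,
      ?_⟩
    refine Lp.ext ((MemLp.coeFn_toLp _).trans ?_)
    filter_upwards [lam.rnDeriv_withDensity₀ hm, hf] with x hx h0
    refine (congrArg ENNReal.toReal hx).trans (ENNReal.toReal_ofReal h0)

instance instCompleteSpace : CompleteSpace (ACFinite lam) := by
  refine (completeSpace_iff_isComplete_range isometry_toL1.isUniformInducing).2 ?_
  rw [range_toL1]
  exact isClosed_Ici.isComplete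

instance instSecondCountableTopology [MeasurableSpace.CountablyGenerated M] :
    SecondCountableTopology (ACFinite lam) :=
  have : Fact ((1 : ℝ≥0∞) ≠ ∞) := ⟨ENNReal.one_ne_top⟩
  isometry_toL1.isEmbedding.secondCountableTopology

theorem integral_eq (μ : ACFinite lam) (f : M → ℝ) :
    ∫ x, f x ∂μ.1 = ∫ x, μ.density x * f x ∂lam :=
  haveI := μ.2.1
  (integral_rnDeriv_smul μ.2.2).symm

theorem integral_sub_integral (μ ν : ACFinite lam) {f : M → ℝ} (hf : Measurable f) {C : ℝ}
    (hC : ∀ x, |f x| ≤ C) :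
    ∫ x, f x ∂μ.1 - ∫ x, f x ∂ν.1 = ∫ x, (μ.density x - ν.density x) * f x ∂lam := by
  rw [integral_eq, integral_eq, ← integral_sub (μ.integrable_density_mul hf hC)
    (ν.integrable_density_mul hf hC)]
  simp only [sub_mul]

theorem abs_integral_sub_le (μ ν : ACFinite lam) {f : M → ℝ} (hf : Measurable f)
    (hC : ∀ x, |f x| ≤ 1) : |∫ x, f x ∂μ.1 - ∫ x, f x ∂ν.1| ≤ dist μ ν := by
  rw [integral_sub_integral μ ν hf hC]
  refine (abs_integral_le_integral_abs).trans (integral_mono_of_nonneg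
    (Eventually.of_forall fun _ => abs_nonneg _)
    (μ.integrable_density.sub ν.integrable_density).abs (Eventually.of_forall fun x => ?_))
  simp only [abs_mul]
  exact mul_le_of_le_one_right (abs_nonneg _) (hC x)

/-- The total variation distance is attained in the limit by bounded continuous functions. -/
theorem exists_boundedContinuous_lt [TopologicalSpace M] [PolishSpace M] [BorelSpace M]
    (μ ν : ACFinite lam) {ε : ℝ} (hε : 0 < ε) :
    ∃ f : BoundedContinuousFunction M ℝ, (∀ x, |f x| ≤ 1) ∧
      dist μ ν - ε < ∫ x, f x ∂μ.1 - ∫ x, f x ∂ν.1 := by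
  have := μ.2.1
  have := ν.2.1
  let _ := TopologicalSpace.upgradeIsCompletelyMetrizable M
  -- This sign function attains the distance. It is approximated in `L¹(μ + ν)` by a continuous
  -- function, then truncated to `[-1, 1]`, which brings it no farther from `s`.
  let s : M → ℝ := fun x => if ν.density x ≤ μ.density x then 1 else -1
  have hs : Measurable s := Measurable.ite
    (measurableSet_le ν.measurable_density μ.measurable_density) measurable_const measurable_const
  have hs1 (x) : |s x| ≤ 1 := by dsimp only [s]; split_ifs <;> simp
  have hsi : Integrable s (μ.1 + ν.1) :=
    .of_bound hs.aestronglyMeasurable 1 (Eventually.of_forall hs1)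
  obtain ⟨g, hg, hgi⟩ := hsi.exists_boundedContinuous_integral_sub_le (half_pos hε)
  have hfc : Continuous fun x => max (-1) (min 1 (g x)) := by fun_prop
  have hf1 (x) : |max (-1) (min 1 (g x))| ≤ 1 :=
    abs_le.2 ⟨le_max_left _ _, max_le (by norm_num) (min_le_left _ _)⟩
  let f : BoundedContinuousFunction M ℝ :=
    BoundedContinuousFunction.ofNormedAddCommGroup _ hfc 1 hf1
  have hfm : Measurable f := f.continuous.measurable
  have hff (x) : |f x| ≤ 1 := hf1 x
  refine ⟨f, hff, ?_⟩
  have hsf (x) : |s x - f x| ≤ |s x - g x| := by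
    have h1 : s x = max (-1) (min 1 (s x)) := by
      rw [min_eq_right (abs_le.1 (hs1 x)).2, max_eq_right (abs_le.1 (hs1 x)).1]
    change |s x - max (-1) (min 1 (g x))| ≤ _
    nth_rw 1 [h1]
    refine (abs_max_sub_max_le_max _ _ _ _).trans (max_le (by simp) ?_)
    exact (abs_min_sub_min_le_max _ _ _ _).trans (max_le (by simp) le_rfl)
  have hd : dist μ ν = ∫ x, s x ∂μ.1 - ∫ x, s x ∂ν.1 := by
    rw [integral_sub_integral μ ν hs hs1, dist_def]
    congr 1 with x
    dsimp only [s]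
    split_ifs with h
    · rw [abs_of_nonneg (by linarith), mul_one]
    · rw [abs_of_nonpos (by linarith)]; ring
  have hi (κ : Measure M) [IsFiniteMeasure κ] : Integrable s κ ∧ Integrable f κ :=
    ⟨.of_bound hs.aestronglyMeasurable 1 (Eventually.of_forall hs1),
      .of_bound hfm.aestronglyMeasurable 1 (Eventually.of_forall hff)⟩
  have hle (κ : Measure M) [IsFiniteMeasure κ] :
      |∫ x, s x ∂κ - ∫ x, f x ∂κ| ≤ ∫ x, |s x - f x| ∂κ := by
    rw [← integral_sub (hi κ).1 (hi κ).2]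
    exact abs_integral_le_integral_abs
  have h1 := (abs_le.1 (hle μ.1)).2
  have h2 := (abs_le.1 (hle ν.1)).1
  have h3 : ∫ x, |s x - f x| ∂μ.1 + ∫ x, |s x - f x| ∂ν.1 ≤ ε / 2 := by
    refine (integral_add_measure (f := fun x => |s x - f x|) ((hi μ.1).1.sub (hi μ.1).2).abs
      ((hi ν.1).1.sub (hi ν.1).2).abs).symm.trans_le ?_
    exact (integral_mono ((hi _).1.sub (hi _).2).abs (hsi.sub hgi).abs hsf).trans hg
  linarith

/-- Two measures are obtained from a common part by adding masses whose sum is the distance. -/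
theorem exists_common_part (μ ν : ACFinite lam) : ∃ κ α β : FiniteMeasure M,
    μ.toFin = κ + α ∧ ν.toFin = κ + β ∧ (α.mass : ℝ) + β.mass = dist μ ν := by
  have := μ.2.1
  have := ν.2.1
  let f := μ.1.rnDeriv lam
  let g := ν.1.rnDeriv lam
  have hf : Measurable f := Measure.measurable_rnDeriv _ _
  have hg : Measurable g := Measure.measurable_rnDeriv _ _
  have hfin (h : M → ℝ≥0∞) (hle : h ≤ f ∨ h ≤ g) : IsFiniteMeasure (lam.withDensity h) := by
    refine isFiniteMeasure_withDensity ?_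
    rcases hle with hle | hle
    · exact ((lintegral_mono hle).trans_lt (Measure.lintegral_rnDeriv_lt_top _ _)).ne
    · exact ((lintegral_mono hle).trans_lt (Measure.lintegral_rnDeriv_lt_top _ _)).ne
  -- Truncated subtraction in `ℝ≥0∞` makes `f - g` and `g - f` the positive and negative parts of
  -- the difference of densities, so the masses of `α` and `β` add up to the distance.
  let κ : FiniteMeasure M :=
    ⟨lam.withDensity fun x => min (f x) (g x), hfin _ (Or.inl fun x => min_le_left _ _)⟩
  let α : FiniteMeasure M := ⟨lam.withDensity (f - g), hfin _ (Or.inl fun x => tsub_le_self)⟩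
  let β : FiniteMeasure M := ⟨lam.withDensity (g - f), hfin _ (Or.inr fun x => tsub_le_self)⟩
  refine ⟨κ, α, β, ?_, ?_, ?_⟩
  · apply FiniteMeasure.toMeasure_injective
    change μ.1 = lam.withDensity (fun x => min (f x) (g x)) + lam.withDensity (f - g)
    rw [← withDensity_add_left (hf.min hg)]
    nth_rw 1 [← Measure.withDensity_rnDeriv_eq _ _ μ.2.2]
    congr 1 with x
    change f x = min (f x) (g x) + (f x - g x)
    rcases le_total (f x) (g x) with h | h
    · rw [min_eq_left h, tsub_eq_zero_of_le h, add_zero]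
    · rw [min_eq_right h, add_tsub_cancel_of_le h]
  · apply FiniteMeasure.toMeasure_injective
    change ν.1 = lam.withDensity (fun x => min (f x) (g x)) + lam.withDensity (g - f)
    rw [← withDensity_add_left (hf.min hg)]
    nth_rw 1 [← Measure.withDensity_rnDeriv_eq _ _ ν.2.2]
    congr 1 with x
    change g x = min (f x) (g x) + (g x - f x)
    rcases le_total (f x) (g x) with h | h
    · rw [min_eq_left h, add_tsub_cancel_of_le h]
    · rw [min_eq_right h, tsub_eq_zero_of_le h, add_zero]
  · rw [dist_def, integral_eq_lintegral_of_nonneg_ae (Eventually.of_forall fun _ => abs_nonneg _)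
      (μ.integrable_abs_sub ν).1, ← NNReal.coe_add]
    have h1 : ((α.mass + β.mass : ℝ≥0) : ℝ≥0∞) =
        ∫⁻ x, ENNReal.ofReal |μ.density x - ν.density x| ∂lam := by
      rw [ENNReal.coe_add, FiniteMeasure.ennreal_mass, FiniteMeasure.ennreal_mass]
      change lam.withDensity (f - g) univ + lam.withDensity (g - f) univ = _
      rw [withDensity_apply _ .univ, withDensity_apply _ .univ, Measure.restrict_univ,
        ← lintegral_add_left (hf.sub hg)]
      refine lintegral_congr_ae ?_
      filter_upwards [μ.1.rnDeriv_lt_top lam, ν.1.rnDeriv_lt_top lam] with x hx hy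
      change (f x - g x) + (g x - f x) = ENNReal.ofReal |(f x).toReal - (g x).toReal|
      rcases le_total (f x) (g x) with h | h
      · have h' := ENNReal.toReal_mono hy.ne h
        rw [tsub_eq_zero_of_le h, zero_add, abs_of_nonpos (by linarith), neg_sub,
          ENNReal.ofReal_sub _ ENNReal.toReal_nonneg, ENNReal.ofReal_toReal hx.ne,
          ENNReal.ofReal_toReal hy.ne]
      · have h' := ENNReal.toReal_mono hx.ne h
        rw [tsub_eq_zero_of_le h, add_zero, abs_of_nonneg (by linarith),
          ENNReal.ofReal_sub _ ENNReal.toReal_nonneg, ENNReal.ofReal_toReal hx.ne,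
          ENNReal.ofReal_toReal hy.ne]
    rw [← h1, ENNReal.coe_toReal]

end ACFinite

variable [SigmaFinite lam]

theorem isClosed_isProbabilityMeasure :
    IsClosed {μ : ACFinite lam | IsProbabilityMeasure μ.1} := by
  have h1 : {μ : ACFinite lam | IsProbabilityMeasure μ.1} =
      (fun μ : ACFinite lam => ∫ _, (1 : ℝ) ∂μ.1) ⁻¹' {1} := by
    ext μ
    have := μ.2.1
    simp only [mem_ofPred_eq, mem_preimage, mem_singleton_iff, integral_const, smul_eq_mul, mul_one,
      Measure.real, ENNReal.toReal_eq_one_iff]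
    exact isProbabilityMeasure_iff
  rw [h1]
  refine isClosed_singleton.preimage
    (LipschitzWith.of_dist_le_mul (K := 1) fun μ ν => ?_).continuous
  simpa [Real.dist_eq] using ACFinite.abs_integral_sub_le μ ν (f := fun _ => 1) measurable_const
    (by simp)

instance instCompleteSpaceACProb : CompleteSpace (ACProb lam) :=
  isClosed_isProbabilityMeasure.completeSpace_coe

end ACSpace

/-! ### Chain rule and uniform bounds -/

section Chain

/-- The chain rule for one-sided quotients along any filter; `dslope` avoids division by `F i - a`,
which may vanish. -/
theorem tendsto_diffQuot_comp {ι : Type*} {l : Filter ι} {F e : ι → ℝ} {a d : ℝ}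
    (he : Tendsto e l (𝓝 0)) (hne : ∀ᶠ i in l, e i ≠ 0)
    (h : Tendsto (fun i => (F i - a) / e i) l (𝓝 d)) {φ : ℝ → ℝ} {φ' : ℝ}
    (hφ : HasDerivAt φ φ' a) : Tendsto (fun i => (φ (F i) - φ a) / e i) l (𝓝 (φ' * d)) := by
  have hF : Tendsto F l (𝓝 a) := by
    have h1 := (h.mul he).add_const a
    rw [mul_zero, zero_add] at h1
    refine h1.congr' ?_
    filter_upwards [hne] with i hi
    rw [div_mul_cancel₀ _ hi, sub_add_cancel]
  have h2 : Tendsto (fun i => dslope φ a (F i)) l (𝓝 φ') := by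
    have h3 : ContinuousAt (dslope φ a) a := continuousAt_dslope_same.2 hφ.differentiableAt
    have h4 := h3.tendsto.comp hF
    rwa [dslope_same, hφ.deriv] at h4
  refine (h2.mul h).congr fun i => ?_
  rw [← sub_smul_dslope φ a (F i), smul_eq_mul]
  ring

theorem exists_bound_comp {φ : ℝ → ℝ} (hφ : ContDiff ℝ 1 φ) {C : ℝ} (hC : 0 ≤ C) :
    ∃ K : ℝ, 0 ≤ K ∧ ∀ a d : ℝ, |a| + |d| ≤ C → |φ a| + |deriv φ a * d| ≤ K := by
  obtain ⟨K₁, h1⟩ := (isCompact_Icc (a := -C) (b := C)).exists_bound_of_continuousOn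
    hφ.continuous.continuousOn
  obtain ⟨K₂, h2⟩ := (isCompact_Icc (a := -C) (b := C)).exists_bound_of_continuousOn
    (hφ.continuous_deriv le_rfl).continuousOn
  have h0 : (0 : ℝ) ∈ Icc (-C) C := ⟨by linarith, hC⟩
  have hK1 := (norm_nonneg _).trans (h1 0 h0)
  have hK2 := (norm_nonneg _).trans (h2 0 h0)
  refine ⟨K₁ + K₂ * C, by positivity, fun a d h => ?_⟩
  have ha : a ∈ Icc (-C) C := abs_le.1 (by linarith [abs_nonneg d])
  rw [abs_mul]
  exact add_le_add (h1 a ha) (mul_le_mul (h2 a ha) (by linarith [abs_nonneg a])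
    (abs_nonneg _) hK2)

/-- A Lipschitz estimate is needed only at distances up to `1`; beyond that, twice the sup bound
takes over. -/
theorem bound_min_dist {E : Type*} [MetricSpace E] {u : E → ℝ} {A B : ℝ} (hA : ∀ x, |u x| ≤ A)
    (hB : ∀ x y, dist x y ≤ 1 → |u x - u y| ≤ B * dist x y) :
    ∃ C : ℝ, (∀ x, |u x| ≤ C) ∧ ∀ x y, |u x - u y| ≤ C * min 1 (dist x y) := by
  refine ⟨max (2 * |A|) B, fun x => ?_, fun x y => ?_⟩
  · exact (hA x).trans ((le_abs_self A).trans ((le_mul_of_one_le_left (abs_nonneg A)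
      one_le_two).trans (le_max_left _ _)))
  · rcases le_total 1 (dist x y) with h | h
    · rw [min_eq_left h, mul_one]
      refine le_max_of_le_left ((abs_sub _ _).trans ?_)
      linarith [hA x, hA y, le_abs_self A]
    · rw [min_eq_right h]
      exact (hB x y h).trans (mul_le_mul_of_nonneg_right (le_max_right _ _) dist_nonneg)

end Chain

/-! ### The core of finite measures -/

section CoreFinite

variable {M : Type*} [TopologicalSpace M] [MeasurableSpace M] [BorelSpace M]

theorem tendsto_coe_nhdsGT_zero : Tendsto (fun ε : ℝ≥0 => (ε : ℝ)) (𝓝[>] 0) (𝓝 0) := by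
  have : Continuous fun ε : ℝ≥0 => (ε : ℝ) := NNReal.continuous_coe
  simpa using (this.tendsto 0).mono_left nhdsWithin_le_nhds

theorem eventually_coe_ne_zero : ∀ᶠ ε : ℝ≥0 in 𝓝[>] 0, (ε : ℝ) ≠ 0 := by
  filter_upwards [self_mem_nhdsWithin] with ε hε
  exact NNReal.coe_ne_zero.2 (ne_of_gt hε)

theorem CbE1Finite_comp {u : FiniteMeasure M → ℝ} (hu : u ∈ CbE1Finite M) {φ : ℝ → ℝ}
    (hφ : ContDiff ℝ 1 φ) : (fun μ => φ (u μ)) ∈ CbE1Finite M := by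
  obtain ⟨hc, D, hD, hDc, C, hC⟩ := hu
  obtain ⟨K, -, hK⟩ := exists_bound_comp hφ (le_max_right C 0)
  refine ⟨hφ.continuous.comp hc, fun μ x => deriv φ (u μ) * D μ x, fun μ x => ?_, ?_, K,
    fun μ x => hK _ _ ((hC μ x).trans (le_max_left _ _))⟩
  · exact tendsto_diffQuot_comp tendsto_coe_nhdsGT_zero eventually_coe_ne_zero (hD μ x)
      (hφ.differentiable one_ne_zero).differentiableAt.hasDerivAt
  · exact ((hφ.continuous_deriv le_rfl).comp (hc.comp continuous_fst)).mul hDc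

theorem exists_bound_CbE1Finite {u : FiniteMeasure M → ℝ} (hu : u ∈ CbE1Finite M) :
    ∃ C : ℝ, ∀ μ, |u μ| ≤ C := by
  obtain ⟨-, D, -, -, C, hC⟩ := hu
  rcases isEmpty_or_nonempty M with hM | ⟨⟨x⟩⟩
  -- The bound in the class ranges over points of `M` and is void here, but `0` is the only measure.
  · refine ⟨|u 0|, fun μ => ?_⟩
    have : μ = 0 := FiniteMeasure.toMeasure_injective (Measure.eq_zero_of_isEmpty _)
    rw [this]
  · exact ⟨C, fun μ => by linarith [hC μ x, abs_nonneg (D μ x)]⟩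

/-- The function `μ ↦ arctan (μ(f) - c)`. -/
theorem arctan_integral_mem_CbE1Finite (f : BoundedContinuousFunction M ℝ) (c : ℝ) :
    (fun μ : FiniteMeasure M => Real.arctan (∫ x, f x ∂(μ : Measure M) - c)) ∈ CbE1Finite M := by
  have hI : Continuous fun μ : FiniteMeasure M => ∫ x, f x ∂(μ : Measure M) :=
    FiniteMeasure.continuous_integral_boundedContinuousFunction f
  refine ⟨Real.continuous_arctan.comp (hI.sub continuous_const),
    fun μ x => 1 / (1 + (∫ x, f x ∂(μ : Measure M) - c) ^ 2) * f x, fun μ x => ?_, ?_, 2 + ‖f‖,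
    fun μ x => ?_⟩
  · refine tendsto_diffQuot_comp (F := fun ε : ℝ≥0 =>
      ∫ y, f y ∂((μ + ε • diracFin x : FiniteMeasure M) : Measure M) - c)
      tendsto_coe_nhdsGT_zero eventually_coe_ne_zero ?_ (Real.hasDerivAt_arctan _)
    refine tendsto_const_nhds.congr' ?_
    filter_upwards [eventually_coe_ne_zero] with ε hε
    have hi (κ : FiniteMeasure M) : Integrable f (κ : Measure M) := f.integrable _
    rw [FiniteMeasure.toMeasure_add, integral_add_measure (hi μ) (hi _),
      FiniteMeasure.toMeasure_smul, toMeasure_diracFin]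
    have h1 : ∫ y, f y ∂(ε • Measure.dirac x) = ε * f x := by
      rw [integral_smul_nnreal_measure, integral_dirac' _ _ f.continuous.stronglyMeasurable]
      rfl
    rw [h1]
    field_simp
    ring
  · have h1 : Continuous fun p : FiniteMeasure M × M => ∫ x, f x ∂(p.1 : Measure M) :=
      hI.comp continuous_fst
    have h2 : Continuous fun p : FiniteMeasure M × M => f p.2 := f.continuous.comp continuous_snd
    refine Continuous.mul (Continuous.div continuous_const (by fun_prop) fun p => ?_) h2
    positivity
  · refine add_le_add (abs_arctan_le_two _) ?_
    rw [abs_mul, abs_of_nonneg (by positivity)]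
    refine (mul_le_of_le_one_left (abs_nonneg _) ?_).trans (f.norm_coe_le_norm x)
    exact div_le_one_of_le₀ (by linarith [sq_nonneg (∫ x, f x ∂(μ : Measure M) - c)])
      (by positivity)

variable [PolishSpace M] {lam : Measure M} [SigmaFinite lam]

/-- Compare both measures with their common part: each differs from it by an added mass, and these
masses sum to the distance. -/
theorem lipschitz_CbE1Finite {u : FiniteMeasure M → ℝ} (hu : u ∈ CbE1Finite M) :
    ∃ C : ℝ, ∀ μ ν : ACFinite lam, |u μ.toFin - u ν.toFin| ≤ C * dist μ ν := by
  obtain ⟨hc, D, hD, -, C, hC⟩ := hu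
  have hC' (μ x) : |D μ x| ≤ C := by linarith [hC μ x, abs_nonneg (u μ)]
  refine ⟨C, fun μ ν => ?_⟩
  obtain ⟨κ, α, β, h1, h2, h3⟩ := μ.exists_common_part ν
  have h4 := abs_add_sub_le_of_isExtrinsicDeriv hc hD hC' κ α
  have h5 := abs_add_sub_le_of_isExtrinsicDeriv hc hD hC' κ β
  rw [← h1] at h4
  rw [← h2, abs_sub_comm] at h5
  rw [← h3, mul_add]
  exact (abs_sub_le _ (u κ) _).trans (add_le_add h4 h5)

/-- Take `f` nearly optimal for the distance from `μ` to `ν`. As `arctan` is increasing, 1-Lipschitz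
and bounded, it carries the estimates for integrals over to bounded functions. -/
theorem ACFinite.arctan_integral_spec (ν μ : ACFinite lam) {ε : ℝ} (hε : 0 < ε) :
    ∃ f : BoundedContinuousFunction M ℝ,
      (∀ γ η : ACFinite lam, |Real.arctan (∫ x, f x ∂γ.1 - ∫ x, f x ∂ν.1) -
        Real.arctan (∫ x, f x ∂η.1 - ∫ x, f x ∂ν.1)| ≤ dist γ η) ∧
      (∀ γ : ACFinite lam, Real.arctan (∫ x, f x ∂γ.1 - ∫ x, f x ∂ν.1) ≤
        Real.arctan (dist γ ν)) ∧
      Real.arctan (dist μ ν) - ε < Real.arctan (∫ x, f x ∂μ.1 - ∫ x, f x ∂ν.1) := by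
  obtain ⟨f, hf, hlt⟩ := μ.exists_boundedContinuous_lt ν hε
  have hle (γ η : ACFinite lam) := ACFinite.abs_integral_sub_le γ η f.continuous.measurable hf
  refine ⟨f, fun γ η => ?_, fun γ => ?_, ?_⟩
  · refine (abs_arctan_sub_arctan_le _ _).trans ?_
    rw [sub_sub_sub_cancel_right]
    exact hle γ η
  · exact Real.arctan_strictMono.monotone ((le_abs_self _).trans (hle γ ν))
  · have h1 := abs_arctan_sub_arctan_le (dist μ ν) (∫ x, f x ∂μ.1 - ∫ x, f x ∂ν.1)
    have h2 := (le_abs_self _).trans (hle μ ν)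
    rw [abs_of_nonneg (a := dist μ ν - _) (by linarith)] at h1
    linarith [le_abs_self (Real.arctan (dist μ ν) -
      Real.arctan (∫ x, f x ∂μ.1 - ∫ x, f x ∂ν.1))]

theorem lipschitzCore_coreFinite : LipschitzCore (coreFinite lam) where
  bound := by
    rintro _ ⟨u, hu, rfl⟩
    obtain ⟨A, hA⟩ := exists_bound_CbE1Finite hu
    obtain ⟨B, hB⟩ := lipschitz_CbE1Finite (lam := lam) hu
    exact bound_min_dist (fun μ => hA μ.toFin) (fun μ ν _ => hB μ ν)
  comp := by
    rintro _ ⟨u, hu, rfl⟩ φ hφ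
    exact ⟨_, CbE1Finite_comp hu hφ, rfl⟩
  approx_dist ν μ ε hε := by
    obtain ⟨f, h1, h2, h3⟩ := ν.arctan_integral_spec μ hε
    exact ⟨_, ⟨_, arctan_integral_mem_CbE1Finite f (∫ x, f x ∂ν.1), rfl⟩,
      fun _ => abs_arctan_le_two _, h1, h2, h3⟩

end CoreFinite

/-! ### The core of probability measures -/

section CoreProb

variable {M : Type*} [TopologicalSpace M] [MeasurableSpace M] [BorelSpace M]

theorem tendsto_unitInterval_coe_nhdsGT_zero :
    Tendsto (fun ε : unitInterval => (ε : ℝ)) (𝓝[>] 0) (𝓝 0) := by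
  have : Continuous fun ε : unitInterval => (ε : ℝ) := continuous_subtype_val
  simpa using (this.tendsto 0).mono_left nhdsWithin_le_nhds

theorem eventually_unitInterval_coe_ne_zero : ∀ᶠ ε : unitInterval in 𝓝[>] 0, (ε : ℝ) ≠ 0 := by
  filter_upwards [self_mem_nhdsWithin] with ε hε
  exact ne_of_gt (show (0 : ℝ) < ε from hε)

theorem CbE1Prob_comp {u : ProbabilityMeasure M → ℝ} (hu : u ∈ CbE1Prob M) {φ : ℝ → ℝ}
    (hφ : ContDiff ℝ 1 φ) : (fun μ => φ (u μ)) ∈ CbE1Prob M := by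
  obtain ⟨hc, D, hD, hDc, C, hC⟩ := hu
  obtain ⟨K, -, hK⟩ := exists_bound_comp hφ (le_max_right C 0)
  refine ⟨hφ.continuous.comp hc, fun μ x => deriv φ (u μ) * D μ x, fun μ x => ?_, ?_, K,
    fun μ x => hK _ _ ((hC μ x).trans (le_max_left _ _))⟩
  · exact tendsto_diffQuot_comp tendsto_unitInterval_coe_nhdsGT_zero
      eventually_unitInterval_coe_ne_zero (hD μ x)
      (hφ.differentiable one_ne_zero).differentiableAt.hasDerivAt
  · exact ((hφ.continuous_deriv le_rfl).comp (hc.comp continuous_fst)).mul hDc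

/-- The integral is affine along `(1 - ε) μ + ε δ_x`, so its difference quotient is constantly `f x
- ∫ f dμ`. -/
theorem integral_mem_CbE1Prob (f : BoundedContinuousFunction M ℝ) :
    (fun μ : ProbabilityMeasure M => ∫ x, f x ∂(μ : Measure M)) ∈ CbE1Prob M := by
  have hI : Continuous fun μ : ProbabilityMeasure M => ∫ x, f x ∂(μ : Measure M) :=
    ProbabilityMeasure.continuous_integral_boundedContinuousFunction f
  have hb (μ : ProbabilityMeasure M) : |∫ x, f x ∂(μ : Measure M)| ≤ ‖f‖ :=
    f.norm_integral_le_norm (μ : Measure M)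
  refine ⟨hI, fun μ x => f x - ∫ x, f x ∂(μ : Measure M), fun μ x => ?_,
    (f.continuous.comp continuous_snd).sub (hI.comp continuous_fst), ‖f‖ + (‖f‖ + ‖f‖),
    fun μ x => add_le_add (hb μ) ((abs_sub _ _).trans
      (add_le_add (f.norm_coe_le_norm x) (hb μ)))⟩
  refine tendsto_const_nhds.congr' ?_
  filter_upwards [eventually_unitInterval_coe_ne_zero] with ε hε
  have h1 : ∫ y, f y ∂(mixDirac ε μ x : Measure M) =
      (1 - (ε : ℝ)) * ∫ y, f y ∂(μ : Measure M) + ε * f x := by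
    change ∫ y, f y ∂(ENNReal.ofReal (1 - (ε : ℝ)) • (μ : Measure M) +
      ENNReal.ofReal (ε : ℝ) • Measure.dirac x) = _
    rw [integral_add_measure ((f.integrable _).smul_measure ENNReal.ofReal_ne_top)
      ((f.integrable _).smul_measure ENNReal.ofReal_ne_top), integral_smul_measure,
      integral_smul_measure, integral_dirac' _ _ f.continuous.stronglyMeasurable,
      ENNReal.toReal_ofReal (sub_nonneg.2 ε.2.2), ENNReal.toReal_ofReal ε.2.1, smul_eq_mul,
      smul_eq_mul]
  rw [h1]
  field_simp
  ring

variable [PolishSpace M] {lam : Measure M} [SigmaFinite lam]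

/-- The estimate through the common part `κ` degenerates as the mass of `κ` tends to `0`. The two
added masses are equal and sum to the distance, so distance at most `1` leaves `κ` with mass at
least `1/2`, whence the constant `2C`. -/
theorem lipschitz_CbE1Prob {u : ProbabilityMeasure M → ℝ} (hu : u ∈ CbE1Prob M) :
    ∃ C : ℝ, ∀ μ ν : ACProb lam, dist μ ν ≤ 1 → |u μ.toProb - u ν.toProb| ≤ C * dist μ ν := by
  obtain ⟨hc, D, hD, -, C, hC⟩ := hu
  have hC' (μ x) : |D μ x| ≤ C := by linarith [hC μ x, abs_nonneg (u μ)]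
  refine ⟨2 * C, fun μ ν hd => ?_⟩
  have hM : Nonempty M := μ.toProb.nonempty
  obtain ⟨x⟩ := id hM
  have hC0 : 0 ≤ C := (abs_nonneg _).trans (hC' μ.toProb x)
  obtain ⟨κ, α, β, h1, h2, h3⟩ := μ.1.exists_common_part ν.1
  change (α.mass : ℝ) + β.mass = dist μ ν at h3
  have m1 : (κ.mass : ℝ) + α.mass = 1 := by
    rw [← NNReal.coe_add, ← mass_add, ← h1]
    exact_mod_cast μ.toProb.mass_toFiniteMeasure
  have m2 : (κ.mass : ℝ) + β.mass = 1 := by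
    rw [← NNReal.coe_add, ← mass_add, ← h2]
    exact_mod_cast ν.toProb.mass_toFiniteMeasure
  have hκ : (1 / 2 : ℝ) ≤ κ.mass := by linarith
  have hκ0 : κ ≠ 0 := by
    rw [← FiniteMeasure.mass_nonzero_iff, ← NNReal.coe_ne_zero]
    linarith
  have hle : C / κ.mass ≤ 2 * C := by
    rw [div_le_iff₀ (by linarith)]
    nlinarith
  have h4 := abs_normalize_add_sub_le hc hD hC' hκ0 α
  have h5 := abs_normalize_add_sub_le hc hD hC' hκ0 β
  have e1 : (κ + α).normalize = μ.toProb :=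
    h1 ▸ ProbabilityMeasure.toFiniteMeasure_normalize_eq_self μ.toProb
  have e2 : (κ + β).normalize = ν.toProb :=
    h2 ▸ ProbabilityMeasure.toFiniteMeasure_normalize_eq_self ν.toProb
  rw [e1] at h4
  rw [e2, abs_sub_comm] at h5
  rw [← h3, mul_add]
  exact (abs_sub_le _ (u κ.normalize) _).trans (add_le_add
    (h4.trans (mul_le_mul_of_nonneg_right hle α.mass.2))
    (h5.trans (mul_le_mul_of_nonneg_right hle β.mass.2)))

theorem lipschitzCore_coreProb : LipschitzCore (coreProb lam) where
  bound := by
    rintro _ ⟨u, hu, rfl⟩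
    obtain ⟨B, hB⟩ := lipschitz_CbE1Prob (lam := lam) hu
    obtain ⟨-, D, -, -, C, hC⟩ := hu
    refine bound_min_dist (A := C) (fun μ => ?_) hB
    obtain ⟨x⟩ := μ.toProb.nonempty
    have := hC μ.toProb x
    change |u μ.toProb| ≤ C
    linarith [abs_nonneg (D μ.toProb x)]
  comp := by
    rintro _ ⟨u, hu, rfl⟩ φ hφ
    exact ⟨_, CbE1Prob_comp hu hφ, rfl⟩
  approx_dist ν μ ε hε := by
    obtain ⟨f, h1, h2, h3⟩ := ν.1.arctan_integral_spec μ.1 hε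
    refine ⟨_, ⟨_, CbE1Prob_comp (integral_mem_CbE1Prob f)
      (φ := fun s => Real.arctan (s - ∫ x, f x ∂ν.1.1)) ?_, rfl⟩,
      fun _ => abs_arctan_le_two _, fun γ η => h1 γ.1 η.1, fun γ => h2 γ.1, h3⟩
    exact Real.contDiff_arctan.comp (contDiff_id.sub contDiff_const)

end CoreProb

end ExtrinsicJump

end

theorem theorem3p1 {M : Type*} [TopologicalSpace M] [PolishSpace M] [MeasurableSpace M]
    [BorelSpace M] (lam : Measure M) [SigmaFinite lam] :
    (∀ (Λ : Measure (ACFinite lam)) [IsProbabilityMeasure Λ]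
        (J : Measure (ACFinite lam × ACFinite lam)) [SigmaFinite J],
      ∫⁻ p, ENNReal.ofReal (min 1 (dist p.1 p.2 ^ 2)) ∂J < ∞ → J ≪ Λ.prod Λ →
      (∀ u ∈ coreFinite lam, MemLp u 2 Λ) ∧
      (∀ u ∈ coreFinite lam, ∀ v ∈ coreFinite lam,
        Integrable (fun p => (u p.1 - u p.2) * (v p.1 - v p.2)) J) ∧
      IsClosable Λ (coreFinite lam) (jumpForm J) ∧
      ∃ 𝓔 : L2Form Λ, IsClosure Λ (coreFinite lam) (jumpForm J) 𝓔 ∧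
        𝓔.IsDirichlet ∧ 𝓔.IsQuasiRegular) ∧
    (∀ (Λ : Measure (ACProb lam)) [IsProbabilityMeasure Λ]
        (J : Measure (ACProb lam × ACProb lam)) [SigmaFinite J],
      ∫⁻ p, ENNReal.ofReal (min 1 (dist p.1 p.2 ^ 2)) ∂J < ∞ → J ≪ Λ.prod Λ →
      (∀ u ∈ coreProb lam, MemLp u 2 Λ) ∧
      (∀ u ∈ coreProb lam, ∀ v ∈ coreProb lam,
        Integrable (fun p => (u p.1 - u p.2) * (v p.1 - v p.2)) J) ∧
      IsClosable Λ (coreProb lam) (jumpForm J) ∧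
      ∃ 𝓔 : L2Form Λ, IsClosure Λ (coreProb lam) (jumpForm J) 𝓔 ∧
        𝓔.IsDirichlet ∧ 𝓔.IsQuasiRegular) :=
  ⟨fun _ _ _ _ hJ1 hJ => lipschitzCore_coreFinite.jumpForm_closure hJ1 hJ,
    fun _ _ _ _ hJ1 hJ => lipschitzCore_coreProb.jumpForm_closure hJ1 hJ⟩
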